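/- Consider the strict-feedback system $$\dot x_i=x_{i+1}+\varphi_i(\bar x_i)^T\theta\ (1\le i\le n-1),\qquad \dot x_n=u+\varphi_n(x)^T\theta,\qquad y=x_1,$$ where $n\ge1$, $x=(x_1,\dots,x_n)$, $\bar x_i=(x_1,\dots,x_i)$, $\theta\in\mathbb R^p$ is constant and $\varphi_i:\mathbb R^i\to\mathbb R^p$ are smooth. Let $r:[0,\infty)\to\mathbb R$ be bounded together with its first $n$ derivatives, with $r^{(n)}$ piecewise continuous (so $r\in C^{n-1}$, and $r^{(n)}$ exists off a locally finite set). Let $\hat\theta$ be a locally absolutely continuous estimate of $\theta$, $\tilde\theta=\theta-\hat\theta$, and let $c_i,\kappa_i,g_i>0$ $(1\le i\le n)$. Define recursively, with $|\cdot|$ the Euclidean norm, $\alpha_0=0$ and, for $i=1,\dots,n$, $$h_i=x_i-\alpha_{i-1}-r^{(i-1)},\qquad w_i=\varphi_i-\sum_{j=1}^{i-1}\frac{\partial\alpha_{i-1}}{\partial x_j}\varphi_j,\qquad s_i=c_i+\kappa_i|w_i|^2+g_i\Big|\frac{\partial\alpha_{i-1}}{\partial\hat\theta}\Big|^2,$$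 $$\alpha_i=-s_ih_i-w_i^T\hat\theta+\sum_{k=1}^{i-1}\Big(\frac{\partial\alpha_{i-1}}{\partial x_k}x_{k+1}+\frac{\partial\alpha_{i-1}}{\partial r^{(k-1)}}r^{(k)}\Big),$$ and the override controller $\bar u=\alpha_n+r^{(n)}$. For $1\le i\le n-1$ put $$\underline c_i=-h_i(0)^{-1}\,b_i,\qquad b_i=\Big[x_{i+1}-r^{(i)}+w_i^T\hat\theta-\sum_{j=1}^{i-1}\Big(\frac{\partial\alpha_{i-1}}{\partial x_j}x_{j+1}+\frac{\partial\alpha_{i-1}}{\partial r^{(j-1)}}r^{(j)}\Big)\Big]_{t=0},$$ where, if $h_i(0)=0$, $\underline c_i$ is read as $-\infty$ when $b_i\ge0$ and as $+\infty$ when $b_i<0$. Let $\underline c=\min_{1\le i\le n}c_i$, $\underline\kappa=\min_{1\le i\le n}\kappa_i$, $\underline g=\min_{2\le i\le n}g_i$. Let $0<t_f\le\infty$ and suppose that a solution $x$ of the closed-loop system with $u=\bar u$ (locally absolutely continuous, the equations holding almost everywhere) is defined on $[0,t_f)$. Suppose that $c_i\ge\max\{\underline c_i,0\}$ for $i=1,\dots,n-1$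 and that $y(0)\ge r(0)$. Below, $\|\cdot\|_\infty$ and $\|\cdot\|_2$ are the $L_\infty$ and $L_2$ norms on $[0,t_f)$; the factor $\frac{\underline c^n-1}{\underline c^{n-1}(\underline c-1)}$ is read as $n$ if $\underline c=1$; and for $n=1$ the terms containing $\underline g$ are omitted. (i) If $\tilde\theta,\dot{\hat\theta}\in L_\infty[0,t_f)$, then $h=(h_1,\dots,h_n)$ and $x$ are bounded on $[0,t_f)$ and, for all $t\in[0,t_f)$, $$-h_1^*\le h_1(t)\le e^{-\underline ct}\sum_{i=1}^n\frac{t^{i-1}}{(i-1)!}h_i(0)+h_1^*,\qquad(\ast)$$ where $$h_1^*=\frac{\underline c^{n}-1}{\underline c^{n-1}(\underline c-1)}\left(\frac{\|\tilde\theta\|_\infty}{2\sqrt{\underline c\,\underline\kappa}}+\frac{\|\dot{\hat\theta}\|_\infty}{2\sqrt{\underline c\,\underline g}}\right).$$ (ii) If $\tilde\theta\in L_\infty[0,t_f)$ and $\dot{\hat\theta}\in L_2[0,t_f)$, then $h$ and $x$ are bounded on $[0,t_f)$ and $(\ast)$ holds with $$h_1^*=\frac{\underline c^{n}-1}{\underline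 c^{n-1}(\underline c-1)}\left(\frac{\|\tilde\theta\|_\infty}{2\sqrt{\underline c\,\underline\kappa}}+\frac{\|\dot{\hat\theta}\|_2}{\sqrt{2\underline g}}\right).$$ -/

import Mathlib

open MeasureTheory Set Filter Topology
open scoped ContDiff ENNReal

noncomputable section

namespace Nonovershooting

/-! Indices are 0-based: for `i : Fin n`, the coordinate `x i`, the regressor `φ i` and the gains
`c i`, `κ i`, `g i` are those which are customarily numbered `i + 1`. The virtual controls are
`α 0 = 0, α 1, …, α n`, indexed by `Fin (n + 1)`, so `α i.castSucc` is the virtual control that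
enters the error variable built from `x i`, and `α i.succ` is the next one. -/

/-- A point `(x, θ̂, ρ)`: plant state, parameter estimate, and the vector
`ρ = (r, r', …, r^(n-1))` of values of the reference and its derivatives. -/
abbrev Pt (n p : ℕ) : Type :=
  EuclideanSpace ℝ (Fin n) × EuclideanSpace ℝ (Fin p) × EuclideanSpace ℝ (Fin n)

variable {n p : ℕ}

/-- The truncated state consisting of the first `i + 1` coordinates of `x`. -/
def trunc (x : EuclideanSpace ℝ (Fin n)) (i : Fin n) : EuclideanSpace ℝ (Fin (i + 1)) :=
  WithLp.toLp 2 fun j => x (Fin.castLE i.isLt j)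

/-- The partial derivative `∂a/∂x_k`. -/
def partialX (a : Pt n p → ℝ) (k : Fin n) (z : Pt n p) : ℝ :=
  lineDeriv ℝ a z (EuclideanSpace.single k 1, 0, 0)

/-- The gradient `∂a/∂θ̂`. -/
def gradTheta (a : Pt n p → ℝ) (z : Pt n p) : EuclideanSpace ℝ (Fin p) :=
  WithLp.toLp 2 fun j => lineDeriv ℝ a z (0, EuclideanSpace.single j 1, 0)

/-- The partial derivative `∂a/∂r^(k)`. -/
def partialR (a : Pt n p → ℝ) (k : Fin n) (z : Pt n p) : ℝ :=
  lineDeriv ℝ a z (0, 0, EuclideanSpace.single k 1)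

/-- The error variable `x_i - a - r^(i)` for the virtual control `a`. -/
def errOf (i : Fin n) (a : Pt n p → ℝ) (z : Pt n p) : ℝ :=
  z.1 i - a z - z.2.2 i

/-- The vector `φ_i - ∑_{j < i} (∂a/∂x_j) φ_j` for the virtual control `a`. -/
def regOf (φ : (i : Fin n) → EuclideanSpace ℝ (Fin (i + 1)) → EuclideanSpace ℝ (Fin p))
    (i : Fin n) (a : Pt n p → ℝ) (z : Pt n p) : EuclideanSpace ℝ (Fin p) :=
  φ i (trunc z.1 i) -
    ∑ j ∈ Finset.univ.filter (fun j : Fin n => j < i), partialX a j z • φ j (trunc z.1 j)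

/-- The nonlinear damping coefficient `c_i + κ_i |w_i|² + g_i |∂a/∂θ̂|²`. -/
def dampOf (φ : (i : Fin n) → EuclideanSpace ℝ (Fin (i + 1)) → EuclideanSpace ℝ (Fin p))
    (c κ g : Fin n → ℝ) (i : Fin n) (a : Pt n p → ℝ) (z : Pt n p) : ℝ :=
  c i + κ i * ‖regOf φ i a z‖ ^ 2 + g i * ‖gradTheta a z‖ ^ 2

/-- The sum `∑_{k < i} ((∂a/∂x_k) x_{k+1} + (∂a/∂r^(k)) r^(k+1))`. -/
def driftOf (i : Fin n) (a : Pt n p → ℝ) (z : Pt n p) : ℝ :=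
  ∑ k : Fin i,
    (partialX a ⟨k, by omega⟩ z * z.1 ⟨k + 1, by omega⟩ +
      partialR a ⟨k, by omega⟩ z * z.2.2 ⟨k + 1, by omega⟩)

/-- The virtual controls `α 0, …, α n`, defined recursively by `α 0 = 0` and
`α (i+1) = - s_i h_i - w_iᵀ θ̂ + ∑_{k < i} ((∂α_i/∂x_k) x_{k+1} + (∂α_i/∂r^(k)) r^(k+1))`. -/
def virtualControl
    (φ : (i : Fin n) → EuclideanSpace ℝ (Fin (i + 1)) → EuclideanSpace ℝ (Fin p))
    (c κ g : Fin n → ℝ) : Fin (n + 1) → Pt n p → ℝ :=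
  Fin.induction (motive := fun _ => Pt n p → ℝ) (fun _ => 0) fun i a z =>
    -(dampOf φ c κ g i a z * errOf i a z) - inner ℝ (regOf φ i a z) z.2.1 + driftOf i a z

/-- The vector `h` of error variables at a point. -/
def err (φ : (i : Fin n) → EuclideanSpace ℝ (Fin (i + 1)) → EuclideanSpace ℝ (Fin p))
    (c κ g : Fin n → ℝ) (z : Pt n p) : EuclideanSpace ℝ (Fin n) :=
  WithLp.toLp 2 fun i => errOf i (virtualControl φ c κ g i.castSucc) z

/-- The override control `ū = α_n + r^(n)`; the value `rn` of `r^(n)` is the last argument. -/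
def overrideControl
    (φ : (i : Fin n) → EuclideanSpace ℝ (Fin (i + 1)) → EuclideanSpace ℝ (Fin p))
    (c κ g : Fin n → ℝ) (z : Pt n p) (rn : ℝ) : ℝ :=
  virtualControl φ c κ g (Fin.last n) z + rn

/-- The bracket
`x_{i+1} - r^(i+1) + w_iᵀ θ̂ - ∑_{j < i} ((∂α_i/∂x_j) x_{j+1} + (∂α_i/∂r^(j)) r^(j+1))`
in the lower bound for the gain `c_i`. -/
def gainBracket (φ : (i : Fin n) → EuclideanSpace ℝ (Fin (i + 1)) → EuclideanSpace ℝ (Fin p))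
    (c κ g : Fin n → ℝ) (z : Pt n p) (i : Fin n) (hi : (i : ℕ) + 1 < n) : ℝ :=
  z.1 ⟨i + 1, hi⟩ - z.2.2 ⟨i + 1, hi⟩
    + inner ℝ (regOf φ i (virtualControl φ c κ g i.castSucc) z) z.2.1
    - driftOf i (virtualControl φ c κ g i.castSucc) z

open Classical in
/-- The lower bound `- h_i⁻¹ * bracket` for the gain `c_i`, evaluated at the initial point `z`.
If `h_i = 0`, the gain has no influence on the next error variable, which then equals the bracket:
no gain is admissible (`⊤`) if the bracket is negative, and there is no restriction (`⊥`)
otherwise. -/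
def gainLower (φ : (i : Fin n) → EuclideanSpace ℝ (Fin (i + 1)) → EuclideanSpace ℝ (Fin p))
    (c κ g : Fin n → ℝ) (z : Pt n p) (i : Fin n) (hi : (i : ℕ) + 1 < n) : EReal :=
  if err φ c κ g z i = 0 then
    (if gainBracket φ c κ g z i hi < 0 then ⊤ else ⊥)
  else ((-(err φ c κ g z i)⁻¹ * gainBracket φ c κ g z i hi : ℝ) : EReal)

/-- The `k`-th derivative of `r` on `[0, ∞)` (one-sided at `0`). -/
def refDeriv (r : ℝ → ℝ) (k : ℕ) (t : ℝ) : ℝ :=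
  iteratedDerivWithin k r (Ici 0) t

/-- Piecewise continuity on `[0, ∞)`, with `S` containing the exceptional points: finitely many in
every bounded interval, with one-sided limits at each of them. -/
def PiecewiseContinuousOff (f : ℝ → ℝ) (S : Set ℝ) : Prop :=
  (∀ T : ℝ, (S ∩ Icc 0 T).Finite) ∧
  (∀ t ∈ Ici (0 : ℝ) \ S, ContinuousWithinAt f (Ici 0) t) ∧
  (∀ t ∈ S, 0 ≤ t → ∃ L, Tendsto f (𝓝[>] t) (𝓝 L)) ∧
  (∀ t ∈ S, 0 < t → ∃ L, Tendsto f (𝓝[<] t) (𝓝 L))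

/-- The standing assumption on the safety boundary `r`: on `[0, ∞)` it is `C^(n-1)`, its `n`-th
derivative exists off a locally finite set and is piecewise continuous, and
`r, r', …, r^(n)` are bounded. -/
structure IsReference (n : ℕ) (r : ℝ → ℝ) : Prop where
  contDiffOn : ContDiffOn ℝ ((n - 1 : ℕ) : WithTop ℕ∞) r (Ici 0)
  piecewise : ∃ S : Set ℝ, PiecewiseContinuousOff (refDeriv r n) S ∧
    ∀ t ∈ Ici (0 : ℝ) \ S, DifferentiableWithinAt ℝ (refDeriv r (n - 1)) (Ici 0) t
  bounded : ∃ M : ℝ, ∀ k ≤ n, ∀ t : ℝ, 0 ≤ t → |refDeriv r k t| ≤ M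

/-- The time interval `[0, t_f)`, where `t_f` may be `∞`. -/
def timeInterval (tf : EReal) : Set ℝ := {t : ℝ | 0 ≤ t ∧ (t : EReal) < tf}

/-- The point `(x(t), θ̂(t), r(t), …, r^(n-1)(t))`. -/
def ptAt (r : ℝ → ℝ) (x : ℝ → EuclideanSpace ℝ (Fin n)) (θhat : ℝ → EuclideanSpace ℝ (Fin p))
    (t : ℝ) : Pt n p :=
  (x t, θhat t, WithLp.toLp 2 fun k : Fin n => refDeriv r k t)

/-- On `[0, t_f)`, `x` is a solution (in the sense of Carathéodory) of the strict-feedback plant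
`x_i' = x_{i+1} + φ_i(x_1, …, x_i)ᵀ θ`, `x_n' = u + φ_n(x)ᵀ θ` under the override control `u = ū`
computed from the parameter estimate `θhat`, which is locally absolutely continuous. -/
structure IsClosedLoop
    (φ : (i : Fin n) → EuclideanSpace ℝ (Fin (i + 1)) → EuclideanSpace ℝ (Fin p))
    (c κ g : Fin n → ℝ) (r : ℝ → ℝ) (θ : EuclideanSpace ℝ (Fin p)) (tf : EReal)
    (x : ℝ → EuclideanSpace ℝ (Fin n)) (θhat : ℝ → EuclideanSpace ℝ (Fin p)) : Prop where
  x_ac : ∀ T ∈ timeInterval tf, AbsolutelyContinuousOnInterval x 0 T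
  θhat_ac : ∀ T ∈ timeInterval tf, AbsolutelyContinuousOnInterval θhat 0 T
  dynamics : ∀ᵐ t ∂(volume.restrict (timeInterval tf)), ∀ i : Fin n,
    HasDerivAt (fun s => x s i)
      ((if hi : (i : ℕ) + 1 < n then x t ⟨i + 1, hi⟩
        else overrideControl φ c κ g (ptAt r x θhat t) (refDeriv r n t))
        + inner ℝ (φ i (trunc (x t) i)) θ) t

/-- The `L_q` norm of a signal on `[0, t_f)`. -/
def sigNorm (q : ℝ≥0∞) (tf : EReal) (v : ℝ → EuclideanSpace ℝ (Fin p)) : ℝ :=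
  (eLpNorm v q (volume.restrict (timeInterval tf))).toReal

/-- The factor `(c^n - 1) / (c^(n-1) (c - 1))`, with its continuous extension `n` at `c = 1`. -/
def geomFactor (n : ℕ) (c : ℝ) : ℝ :=
  if c = 1 then n else (c ^ n - 1) / (c ^ (n - 1) * (c - 1))

/-- `min_{i ≥ 2} g_i` (1-based numbering). It is used only if `n ≥ 2`. -/
def minTail (g : Fin n → ℝ) : ℝ := ⨅ i : {i : Fin n // 0 < (i : ℕ)}, g i

/-- The violation bound in terms of the norms `a = ‖θ̃‖_∞` and `b = ‖θ̂'‖_∞`. For `n = 1` the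
minimum of the `g_i`, `i ≥ 2`, is over the empty set and the second term is absent. -/
def violationInf (c κ g : Fin n → ℝ) (a b : ℝ) : ℝ :=
  geomFactor n (⨅ i, c i) *
    (a / (2 * √((⨅ i, c i) * ⨅ i, κ i)) +
      if n = 1 then 0 else b / (2 * √((⨅ i, c i) * minTail g)))

/-- The violation bound in terms of the norms `a = ‖θ̃‖_∞` and `b = ‖θ̂'‖_2`, with the same
convention for `n = 1`. -/
def violationTwo (c κ g : Fin n → ℝ) (a b : ℝ) : ℝ :=
  geomFactor n (⨅ i, c i) *
    (a / (2 * √((⨅ i, c i) * ⨅ i, κ i)) +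
      if n = 1 then 0 else b / √(2 * minTail g))

/-- The common conclusion for error and plant trajectories `h`, `x` on `[0, t_f)`: both are bounded
and `-H ≤ h_1(t) ≤ e^(-c̲ t) ∑_i t^(i-1)/(i-1)! h_i(0) + H`, where `c̲ = min_i c_i`. -/
def SafeBound (hn : 1 ≤ n) (c : Fin n → ℝ) (tf : EReal)
    (h x : ℝ → EuclideanSpace ℝ (Fin n)) (H : ℝ) : Prop :=
  (∃ M : ℝ, ∀ t ∈ timeInterval tf, ‖h t‖ ≤ M) ∧
  (∃ M : ℝ, ∀ t ∈ timeInterval tf, ‖x t‖ ≤ M) ∧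
  ∀ t ∈ timeInterval tf,
    -H ≤ h t ⟨0, hn⟩ ∧
    h t ⟨0, hn⟩ ≤
      Real.exp (-(⨅ i, c i) * t) * ∑ i : Fin n, t ^ (i : ℕ) / ((i : ℕ).factorial : ℝ) * h 0 i + H

end Nonovershooting

end

/-! In the 1-based notation of the statement, the virtual controls cancel every known term of the
error dynamics, leaving the chain `h_i' = h_{i+1} - s_i h_i + d_i` with `h_{n+1} = 0` and `d_i =
w_iᵀ θ̃ - (∂α_{i-1}/∂θ̂) θ̂'` (`IsClosedLoop.ae_hasDerivAt_err`). The gain conditions make all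
`h_i(0)` nonnegative, because `h_{i+1}(0) = b_i + s_i h_i(0)` and `s_i ≥ c_i` (`err_nonneg`).

Each equation is solved with the integrating factor `F = exp ∫ s_i`. The damping contains exactly
the squares that dominate the perturbation: by AM-GM, `|w_i| ‖θ̃‖_∞ ≤ A s_i` with `A = ‖θ̃‖_∞ /
(2√(c̲ κ̲))`, and `∫ F s_i = F(T) - 1`, so this term moves `h_i(T)` by at most `A`. The same works
for a bounded `θ̂'`. For a square integrable `θ̂'`, Cauchy-Schwarz and `∫ F² s_i = (F(T)² - 1)/2`
give `‖θ̂'‖_2 / √(2 g̲)` instead (`integral_exp_mul_abs_le`, `integral_exp_mul_abs_le_of_sq`). Let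
`D` be the total.

Going up the chain from `h_{n+1} = 0`, a violation `S` of `h_{i+1}` becomes `S / c̲ + D` for `h_i`,
which sums to the geometric factor; the transient of `h_{i+1}` is integrated once and picks up
`h_i(0)`, which produces the polynomial in `t` (`comparison`, `cascade`). Lower bounds carry no
transient since the initial values are nonnegative.

Finally, `x_i = h_i + α_{i-1} + r^(i-1)`, and `α_{i-1}` sees only the first `i - 1` states, so
boundedness of `x` follows by induction on `i` (`bounded_state`). -/

noncomputable section

namespace Nonovershooting

/-! ### Scalar equations with damping: integrating factor and comparison. -/

section Comparison

variable {s : ℝ → ℝ} {T c : ℝ}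

theorem hasDerivAt_exp_integral (hs : Continuous s) (t : ℝ) :
    HasDerivAt (fun t => Real.exp (∫ τ in (0 : ℝ)..t, s τ))
      (Real.exp (∫ τ in (0 : ℝ)..t, s τ) * s t) t :=
  (intervalIntegral.integral_hasDerivAt_right (hs.intervalIntegrable _ _)
    (hs.stronglyMeasurableAtFilter _ _) hs.continuousAt).exp

theorem continuous_exp_integral (hs : Continuous s) :
    Continuous fun t => Real.exp (∫ τ in (0 : ℝ)..t, s τ) :=
  continuous_iff_continuousAt.2 fun t => (hasDerivAt_exp_integral hs t).continuousAt

theorem absolutelyContinuous_exp_integral (hs : Continuous s) (a b : ℝ) :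
    AbsolutelyContinuousOnInterval (fun t => Real.exp (∫ τ in (0 : ℝ)..t, s τ)) a b := by
  refine ContDiffOn.absolutelyContinuousOnInterval (ContDiff.contDiffOn ?_)
  refine contDiff_one_iff_deriv.2 ⟨fun t => (hasDerivAt_exp_integral hs t).differentiableAt, ?_⟩
  have : deriv (fun t => Real.exp (∫ τ in (0 : ℝ)..t, s τ)) =
      fun t => Real.exp (∫ τ in (0 : ℝ)..t, s τ) * s t :=
    funext fun t => (hasDerivAt_exp_integral hs t).deriv
  rw [this]
  exact (continuous_exp_integral hs).mul hs

theorem integral_exp_mul (hs : Continuous s) (T : ℝ) :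
    ∫ t in (0 : ℝ)..T, Real.exp (∫ τ in (0 : ℝ)..t, s τ) * s t =
      Real.exp (∫ τ in (0 : ℝ)..T, s τ) - 1 := by
  rw [intervalIntegral.integral_eq_sub_of_hasDerivAt
    (fun t _ => hasDerivAt_exp_integral hs t)
    (((continuous_exp_integral hs).mul hs).intervalIntegrable _ _)]
  simp

/-- The integrand is the derivative of `F² / 2`; this half is the source of the `√2` in the `L_2`
bound. -/
theorem integral_exp_sq_mul (hs : Continuous s) (T : ℝ) :
    ∫ t in (0 : ℝ)..T, Real.exp (∫ τ in (0 : ℝ)..t, s τ) ^ 2 * s t =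
      (Real.exp (∫ τ in (0 : ℝ)..T, s τ) ^ 2 - 1) / 2 := by
  have hd : ∀ t, HasDerivAt (fun t => Real.exp (∫ τ in (0 : ℝ)..t, s τ) ^ 2 / 2)
      (Real.exp (∫ τ in (0 : ℝ)..t, s τ) ^ 2 * s t) t := by
    intro t
    convert! ((hasDerivAt_exp_integral hs t).pow 2).div_const 2 using 1
    ring
  rw [intervalIntegral.integral_eq_sub_of_hasDerivAt (fun t _ => hd t)
    ((((continuous_exp_integral hs).pow 2).mul hs).intervalIntegrable _ _)]
  simp
  ring

/-- Integrating `s ≥ c` over `[t, T]` gives `F(T) / F(t) ≥ e^(c (T - t))`. This replaces the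
state-dependent rate by the fixed rate `c`. -/
theorem exp_integral_le (hs : Continuous s) (hsc : ∀ t ∈ Icc 0 T, c ≤ s t) {t : ℝ}
    (ht : t ∈ Icc 0 T) :
    Real.exp (∫ τ in (0 : ℝ)..t, s τ) ≤
      Real.exp (∫ τ in (0 : ℝ)..T, s τ) * Real.exp (-c * T) * Real.exp (c * t) := by
  rw [← Real.exp_add, ← Real.exp_add, Real.exp_le_exp,
    ← intervalIntegral.integral_add_adjacent_intervals (hs.intervalIntegrable 0 t)
      (hs.intervalIntegrable t T)]
  have h1 : ∫ _ in t..T, c ≤ ∫ τ in t..T, s τ :=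
    intervalIntegral.integral_mono_on ht.2 (by simp) (hs.intervalIntegrable _ _)
      fun x hx => hsc x ⟨ht.1.trans hx.1, hx.2⟩
  simp at h1
  linarith

/-- The perturbation in an absolutely continuous solution of `h' = e - s h + d` is integrable. -/
theorem intervalIntegrable_perturbation (hs : Continuous s) (hT : 0 ≤ T) {h e d : ℝ → ℝ}
    (hh : AbsolutelyContinuousOnInterval h 0 T) (he : ContinuousOn e (Icc 0 T))
    (hd : ∀ᵐ t, t ∈ Icc 0 T → HasDerivAt h (e t - s t * h t + d t) t) :
    IntervalIntegrable d volume 0 T := by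
  have hcont : ContinuousOn (fun t => s t * h t - e t) (uIcc 0 T) := by
    rw [uIcc_of_le hT]
    have := hh.continuousOn
    rw [uIcc_of_le hT] at this
    exact (hs.continuousOn.mul this).sub he
  -- Almost everywhere `d = h' + (s h - e)`, and the derivative of an absolutely continuous function
  -- is integrable.
  refine (hh.intervalIntegrable_deriv.add hcont.intervalIntegrable).congr_ae ?_
  rw [EventuallyEq, ae_restrict_iff' measurableSet_uIoc]
  filter_upwards [hd] with t ht hm
  rw [uIoc_of_le hT] at hm
  simp only [(ht (Ioc_subset_Icc_self hm)).deriv]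
  ring

/-- Comparison principle for `h' = e - s h + d`, where the effect of the perturbation `d`
is measured through the variation of constants formula. -/
theorem comparison (hs : Continuous s) (hT : 0 ≤ T) (hc : 0 < c) (hsc : ∀ t ∈ Icc 0 T, c ≤ s t)
    {h e d p : ℝ → ℝ} {D D' p₀ : ℝ}
    (hh : AbsolutelyContinuousOnInterval h 0 T) (he : ContinuousOn e (Icc 0 T))
    (hd : ∀ᵐ t, t ∈ Icc 0 T → HasDerivAt h (e t - s t * h t + d t) t)
    (hp : Continuous p) (hp_nonneg : ∀ t ∈ Icc 0 T, 0 ≤ p t) (hD' : 0 ≤ D')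
    (hep : ∀ t ∈ Icc 0 T, e t ≤ Real.exp (-c * t) * p t + D')
    (h0 : h 0 ≤ p₀) (hp₀ : 0 ≤ p₀)
    (hD : ∫ t in (0 : ℝ)..T, Real.exp (∫ τ in (0 : ℝ)..t, s τ) * |d t| ≤
      D * Real.exp (∫ τ in (0 : ℝ)..T, s τ)) :
    h T ≤ Real.exp (-c * T) * (p₀ + ∫ t in (0 : ℝ)..T, p t) + (D' / c + D) := by
  set F : ℝ → ℝ := fun t => Real.exp (∫ τ in (0 : ℝ)..t, s τ) with hF
  have hFc : Continuous F := continuous_exp_integral hs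
  have hF0 : F 0 = 1 := by simp [hF]
  have hFpos : ∀ t, 0 < F t := fun t => Real.exp_pos _
  have hFT : ∀ t ∈ Icc 0 T, F t ≤ F T * Real.exp (-c * T) * Real.exp (c * t) :=
    fun t ht => exp_integral_le hs hsc ht
  have hdi := intervalIntegrable_perturbation hs hT hh he hd
  -- The equation holds only almost everywhere, so the fundamental theorem is used for the
  -- absolutely continuous product `F h`.
  have key : ∫ t in (0 : ℝ)..T, deriv (fun t => F t * h t) t = F T * h T - F 0 * h 0 :=
    ((absolutelyContinuous_exp_integral hs 0 T).fun_mul hh).integral_deriv_eq_sub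
  have hderiv : ∫ t in (0 : ℝ)..T, deriv (fun t => F t * h t) t =
      ∫ t in (0 : ℝ)..T, F t * (e t + d t) := by
    refine intervalIntegral.integral_congr_ae ?_
    filter_upwards [hd] with t ht hm
    rw [uIoc_of_le hT] at hm
    have := (hasDerivAt_exp_integral hs t).mul (ht (Ioc_subset_Icc_self hm))
    refine (HasDerivAt.deriv this).trans ?_
    simp only [hF]
    ring
  have hcu : ∀ {f : ℝ → ℝ}, ContinuousOn f (Icc 0 T) → ContinuousOn f (uIcc 0 T) := by
    intro f hf; rwa [uIcc_of_le hT]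
  have i1 : IntervalIntegrable (fun t => F t * e t) volume 0 T :=
    (hcu (hFc.continuousOn.mul he)).intervalIntegrable
  have i2 : IntervalIntegrable (fun t => F t * |d t|) volume 0 T :=
    hdi.abs.continuousOn_mul hFc.continuousOn
  have i3 : Continuous fun t => F T * Real.exp (-c * T) * (p t + D' * Real.exp (c * t)) := by
    fun_prop
  have m1 : ∫ t in (0 : ℝ)..T, F t * (e t + d t) ≤
      (∫ t in (0 : ℝ)..T, F t * e t) + ∫ t in (0 : ℝ)..T, F t * |d t| := by
    rw [← intervalIntegral.integral_add i1 i2]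
    refine intervalIntegral.integral_mono_on hT ?_ (i1.add i2) fun t _ => ?_
    · simp_rw [mul_add]
      exact i1.add (hdi.continuousOn_mul hFc.continuousOn)
    · rw [mul_add]
      have := mul_le_mul_of_nonneg_left (le_abs_self (d t)) (hFpos t).le
      linarith
  have m2 : ∫ t in (0 : ℝ)..T, F t * e t ≤
      ∫ t in (0 : ℝ)..T, F T * Real.exp (-c * T) * (p t + D' * Real.exp (c * t)) := by
    refine intervalIntegral.integral_mono_on hT i1 (i3.intervalIntegrable _ _) fun t ht => ?_
    have h1 : 0 ≤ Real.exp (-c * t) * p t + D' :=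
      add_nonneg (mul_nonneg (Real.exp_pos _).le (hp_nonneg t ht)) hD'
    calc F t * e t ≤ F t * (Real.exp (-c * t) * p t + D') :=
          mul_le_mul_of_nonneg_left (hep t ht) (hFpos t).le
      _ ≤ F T * Real.exp (-c * T) * Real.exp (c * t) * (Real.exp (-c * t) * p t + D') :=
          mul_le_mul_of_nonneg_right (hFT t ht) h1
      _ = F T * Real.exp (-c * T) *
            (Real.exp (c * t) * Real.exp (-c * t) * p t + D' * Real.exp (c * t)) := by ring
      _ = _ := by
          have : Real.exp (c * t) * Real.exp (-c * t) = 1 := by rw [← Real.exp_add]; simp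
          rw [this, one_mul]
  have m3 : ∫ t in (0 : ℝ)..T, F T * Real.exp (-c * T) * (p t + D' * Real.exp (c * t)) =
      F T * Real.exp (-c * T) * ((∫ t in (0 : ℝ)..T, p t) +
        D' * ((Real.exp (c * T) - 1) / c)) := by
    rw [intervalIntegral.integral_const_mul, intervalIntegral.integral_add
      (hp.intervalIntegrable _ _) (Continuous.intervalIntegrable (by fun_prop) _ _),
      intervalIntegral.integral_const_mul]
    congr 3
    rw [intervalIntegral.integral_eq_sub_of_hasDerivAt (f := fun t => Real.exp (c * t) / c)]
    · simp [sub_div]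
    · intro t _
      have := (((hasDerivAt_id t).const_mul c).exp).div_const c
      convert! this using 1
      simp; field_simp
    · exact Continuous.intervalIntegrable (by fun_prop) _ _
  have hE : Real.exp (-c * T) * Real.exp (c * T) = 1 := by rw [← Real.exp_add]; simp
  have fin : F T * h T ≤ F T * (Real.exp (-c * T) * (p₀ + ∫ t in (0 : ℝ)..T, p t) +
      (D' / c + D)) := by
    have e1 : F T * h T = h 0 + ∫ t in (0 : ℝ)..T, F t * (e t + d t) := by
      rw [← hderiv, key, hF0]; ring
    -- The factor `F T * exp (-c * T)` is at least `1`, so inserting it only enlarges the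
    -- nonnegative `p₀`.
    have e2 : h 0 ≤ F T * Real.exp (-c * T) * p₀ := by
      have := hFT 0 ⟨le_rfl, hT⟩
      rw [hF0] at this
      simp at this
      refine h0.trans ?_
      have h2 := mul_le_mul_of_nonneg_right this hp₀
      simpa using h2
    have e3 : F T * Real.exp (-c * T) * (D' * ((Real.exp (c * T) - 1) / c)) ≤ F T * (D' / c) := by
      have : F T * Real.exp (-c * T) * (D' * ((Real.exp (c * T) - 1) / c)) =
        F T * (D' / c) * (Real.exp (-c * T) * Real.exp (c * T) - Real.exp (-c * T)) := by ring
      rw [this, hE]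
      have h3 : 0 ≤ F T * (D' / c) := by have := hFpos T; positivity
      have h4 := (Real.exp_pos (-c * T)).le
      nlinarith
    have e4 : D * F T = F T * D := mul_comm _ _
    rw [e1]
    nlinarith [m1, m2, m3, hD]
  exact le_of_mul_le_mul_left fin (hFpos T)

/-- A perturbation dominated by the damping rate. -/
theorem integral_exp_mul_abs_le (hs : Continuous s) (hT : 0 ≤ T) {d : ℝ → ℝ} {A : ℝ} (hA : 0 ≤ A)
    (hdi : IntervalIntegrable d volume 0 T)
    (hd : ∀ᵐ t, t ∈ Icc 0 T → |d t| ≤ A * s t) :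
    ∫ t in (0 : ℝ)..T, Real.exp (∫ τ in (0 : ℝ)..t, s τ) * |d t| ≤
      A * Real.exp (∫ τ in (0 : ℝ)..T, s τ) := by
  have hFc := continuous_exp_integral hs
  calc _ ≤ ∫ t in (0 : ℝ)..T, A * (Real.exp (∫ τ in (0 : ℝ)..t, s τ) * s t) := by
        refine intervalIntegral.integral_mono_ae_restrict hT
          (hdi.abs.continuousOn_mul hFc.continuousOn)
          ((continuous_const.mul (hFc.mul hs)).intervalIntegrable _ _) ?_
        rw [EventuallyLE, ae_restrict_iff' measurableSet_Icc]
        filter_upwards [hd] with t ht hm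
        have := mul_le_mul_of_nonneg_left (ht hm) (Real.exp_pos (∫ τ in (0 : ℝ)..t, s τ)).le
        linarith
    _ ≤ _ := by
        rw [intervalIntegral.integral_const_mul, integral_exp_mul hs]
        nlinarith

/-- A perturbation with a square integrable factor, damped through `s ≥ γ q²`. -/
theorem integral_exp_mul_abs_le_of_sq (hs : Continuous s) (hT : 0 ≤ T) {d q β : ℝ → ℝ}
    {A b γ : ℝ} (hA : 0 ≤ A) (hγ : 0 < γ) (hb : 0 ≤ b)
    (hdi : IntervalIntegrable d volume 0 T)
    (hq : ContinuousOn q (Icc 0 T)) (hq0 : ∀ t, 0 ≤ q t) (hβ0 : ∀ t, 0 ≤ β t)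
    (hqs : ∀ t ∈ Icc 0 T, γ * q t ^ 2 ≤ s t)
    (hβ : MemLp β 2 (volume.restrict (Ioc 0 T))) (hβb : ∫ t in (0 : ℝ)..T, β t ^ 2 ≤ b ^ 2)
    (hd : ∀ᵐ t, t ∈ Icc 0 T → |d t| ≤ A * s t + q t * β t) :
    ∫ t in (0 : ℝ)..T, Real.exp (∫ τ in (0 : ℝ)..t, s τ) * |d t| ≤
      (A + b / √(2 * γ)) * Real.exp (∫ τ in (0 : ℝ)..T, s τ) := by
  have hFc := continuous_exp_integral hs
  set F : ℝ → ℝ := fun t => Real.exp (∫ τ in (0 : ℝ)..t, s τ) with hF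
  have hFpos : ∀ t, 0 < F t := fun t => Real.exp_pos _
  have hfc : ContinuousOn (fun t => F t * q t) (Icc 0 T) := hFc.continuousOn.mul hq
  have hf2 : MemLp (fun t => F t * q t) 2 (volume.restrict (Ioc 0 T)) := by
    obtain ⟨C, hC⟩ := isCompact_Icc.exists_bound_of_continuousOn hfc
    refine MemLp.of_bound
      ((hfc.mono Ioc_subset_Icc_self).aestronglyMeasurable measurableSet_Ioc) C ?_
    rw [ae_restrict_iff' measurableSet_Ioc]
    exact Eventually.of_forall fun t ht => hC t (Ioc_subset_Icc_self ht)
  have iprod : IntervalIntegrable (fun t => F t * q t * β t) volume 0 T := by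
    rw [intervalIntegrable_iff_integrableOn_Ioc_of_le hT]
    exact hf2.integrable_mul hβ
  -- Cauchy-Schwarz with the weight `F` kept on `q`: then `γ q² ≤ s` reduces the first factor to the
  -- exact integral of `F² s`, of size `F(T)²`, and division by `F(T)` leaves a constant.
  have holder : ∫ t in (0 : ℝ)..T, F t * q t * β t ≤
      √(∫ t in (0 : ℝ)..T, (F t * q t) ^ 2) * √(∫ t in (0 : ℝ)..T, β t ^ 2) := by
    have := integral_mul_le_Lp_mul_Lq_of_nonneg (μ := volume.restrict (Ioc 0 T))
      Real.HolderConjugate.two_two (f := fun t => F t * q t) (g := β)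
      (Eventually.of_forall fun t => mul_nonneg (hFpos t).le (hq0 t))
      (Eventually.of_forall hβ0) (by simpa using hf2) (by simpa using hβ)
    simp only [intervalIntegral.integral_of_le hT, Real.sqrt_eq_rpow]
    simpa only [Real.rpow_two] using this
  have hsq : ∫ t in (0 : ℝ)..T, (F t * q t) ^ 2 ≤ (F T / √(2 * γ)) ^ 2 := by
    have h1 : ∫ t in (0 : ℝ)..T, (F t * q t) ^ 2 ≤ ∫ t in (0 : ℝ)..T, γ⁻¹ * (F t ^ 2 * s t) := by
      refine intervalIntegral.integral_mono_on hT ?_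
        (Continuous.intervalIntegrable (by fun_prop) _ _) fun t ht => ?_
      · refine ContinuousOn.intervalIntegrable ?_
        rw [uIcc_of_le hT]; exact hfc.pow 2
      · have := mul_le_mul_of_nonneg_left (hqs t ht) (sq_nonneg (F t))
        rw [le_inv_mul_iff₀ hγ]
        linarith
    rw [intervalIntegral.integral_const_mul, integral_exp_sq_mul hs] at h1
    refine h1.trans ?_
    rw [div_pow, Real.sq_sqrt (by positivity)]
    rw [inv_mul_le_iff₀ hγ]
    have : γ * (F T ^ 2 / (2 * γ)) = F T ^ 2 / 2 := by field_simp
    rw [this]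
    simp only [hF]
    linarith
  have hbound : ∫ t in (0 : ℝ)..T, F t * q t * β t ≤ b / √(2 * γ) * F T := by
    refine holder.trans ?_
    have h1 : √(∫ t in (0 : ℝ)..T, (F t * q t) ^ 2) ≤ F T / √(2 * γ) :=
      Real.sqrt_le_iff.2 ⟨by have := hFpos T; positivity, hsq⟩
    have h2 : √(∫ t in (0 : ℝ)..T, β t ^ 2) ≤ b := Real.sqrt_le_iff.2 ⟨hb, hβb⟩
    calc _ ≤ F T / √(2 * γ) * b :=
          mul_le_mul h1 h2 (Real.sqrt_nonneg _) (by have := hFpos T; positivity)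
      _ = _ := by ring
  have is : IntervalIntegrable (fun t => A * (F t * s t)) volume 0 T :=
    Continuous.intervalIntegrable (by fun_prop) _ _
  calc _ ≤ ∫ t in (0 : ℝ)..T, (A * (F t * s t) + F t * q t * β t) := by
        refine intervalIntegral.integral_mono_ae_restrict hT
          (hdi.abs.continuousOn_mul hFc.continuousOn) (is.add iprod) ?_
        rw [EventuallyLE, ae_restrict_iff' measurableSet_Icc]
        filter_upwards [hd] with t ht hm
        have := mul_le_mul_of_nonneg_left (ht hm) (hFpos t).le
        simp only [hF] at *
        linarith
    _ ≤ _ := by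
        rw [intervalIntegral.integral_add is iprod, intervalIntegral.integral_const_mul,
          integral_exp_mul hs]
        simp only [hF] at hbound ⊢
        nlinarith

end Comparison

/-! ### Bounds along a chain of equations, and the constants they produce. -/

theorem integral_sum_pow_div_factorial (a : ℕ → ℝ) (m : ℕ) (t : ℝ) :
    a 0 + ∫ τ in (0 : ℝ)..t, ∑ j ∈ Finset.range m, τ ^ j / (j.factorial : ℝ) * a (j + 1) =
      ∑ j ∈ Finset.range (m + 1), t ^ j / (j.factorial : ℝ) * a j := by
  rw [intervalIntegral.integral_finsetSum
    fun j _ => Continuous.intervalIntegrable (by fun_prop) _ _, Finset.sum_range_succ', add_comm]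
  congr 1
  · refine Finset.sum_congr rfl fun j _ => ?_
    rw [intervalIntegral.integral_mul_const, intervalIntegral.integral_div, integral_pow,
      Nat.factorial_succ]
    push_cast
    have : (j.factorial : ℝ) ≠ 0 := by positivity
    field_simp
    simp
  · simp

/-- Bounds for a chain of perturbed scalar equations `h_i' = h_{i+1} - s_i h_i + d_i` with
nonnegative initial values. -/
theorem cascade {n : ℕ} {c D T : ℝ} (hc : 0 < c) (hD : 0 ≤ D) {h s d : ℕ → ℝ → ℝ}
    (hs : ∀ i < n, Continuous (s i)) (hsc : ∀ i < n, ∀ t ∈ Icc 0 T, c ≤ s i t)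
    (hlast : ∀ t, h n t = 0) (hac : ∀ i < n, AbsolutelyContinuousOnInterval (h i) 0 T)
    (hd : ∀ i < n, ∀ᵐ t, t ∈ Icc 0 T →
      HasDerivAt (h i) (h (i + 1) t - s i t * h i t + d i t) t)
    (h0 : ∀ i < n, 0 ≤ h i 0)
    (hDb : ∀ i < n, ∀ t ∈ Icc 0 T,
      ∫ u in (0 : ℝ)..t, Real.exp (∫ τ in (0 : ℝ)..u, s i τ) * |d i u| ≤
        D * Real.exp (∫ τ in (0 : ℝ)..t, s i τ)) (m : ℕ) :
    ∀ i, i + m = n → ∀ t ∈ Icc 0 T,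
      -(D * ∑ k ∈ Finset.range m, c⁻¹ ^ k) ≤ h i t ∧
      h i t ≤ Real.exp (-c * t) *
        (∑ j ∈ Finset.range m, t ^ j / (j.factorial : ℝ) * h (i + j) 0) +
        D * ∑ k ∈ Finset.range m, c⁻¹ ^ k := by
  -- `m` is the number of equations from index `i` to the end; the induction starts at the zero
  -- function `h n` and descends in `i`.
  induction m with
  | zero =>
    intro i hi t _
    obtain rfl : i = n := by omega
    simp [hlast]
  | succ m ih =>
    intro i hi t ht
    have hin : i < n := by omega
    have ih := ih (i + 1) (by omega)
    set S := D * ∑ k ∈ Finset.range m, c⁻¹ ^ k with hS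
    have hS0 : 0 ≤ S := mul_nonneg hD (Finset.sum_nonneg fun k _ => by positivity)
    -- The geometric sum is the solution of the recursion `S ↦ S / c + D` from `comparison`.
    have hS' : D * ∑ k ∈ Finset.range (m + 1), c⁻¹ ^ k = S / c + D := by
      rw [Finset.sum_range_succ', mul_add, hS, mul_div_assoc, Finset.sum_div]
      simp [pow_succ, div_eq_mul_inv]
    have hsub : Icc 0 t ⊆ Icc 0 T := Icc_subset_Icc_right ht.2
    have hsub' : uIcc 0 t ⊆ uIcc 0 T := by rwa [uIcc_of_le ht.1, uIcc_of_le (ht.1.trans ht.2)]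
    have hact := (hac i hin).mono hsub'
    have hec : ContinuousOn (h (i + 1)) (Icc 0 t) := by
      rcases (show i + 1 < n ∨ i + 1 = n by omega) with h1 | h1
      · have := ((hac _ h1).mono hsub').continuousOn
        rwa [uIcc_of_le ht.1] at this
      · subst h1
        exact continuousOn_const.congr fun t _ => hlast t
    have hdt : ∀ᵐ u, u ∈ Icc 0 t →
        HasDerivAt (h i) (h (i + 1) u - s i u * h i u + d i u) u := by
      filter_upwards [hd i hin] with u hu hm using hu (hsub hm)
    -- `comparison` replaces `F` by a larger weight under the transient, which therefore has to be
    -- nonnegative; this is where the signs of the later initial values enter.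
    have hpos : ∀ u ∈ Icc 0 t,
        0 ≤ ∑ j ∈ Finset.range m, u ^ j / (j.factorial : ℝ) * h (i + 1 + j) 0 := by
      refine fun u hu => Finset.sum_nonneg fun j hj => mul_nonneg ?_ (h0 _ ?_)
      · have := hu.1
        positivity
      · have := Finset.mem_range.1 hj
        omega
    constructor
    -- Lower bound: applied to `-h i`, whose initial value is at most `0`, so no transient is
    -- needed.
    · have := comparison (c := c) (hs i hin) ht.1 hc (fun u hu => hsc i hin u (hsub hu))
        (h := fun u => -h i u) (e := fun u => -h (i + 1) u) (d := fun u => -d i u)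
        (p := fun _ => 0) (D := D) (D' := S) (p₀ := 0) hact.fun_neg hec.neg
        (by
          filter_upwards [hdt] with u hu hm
          convert! (hu hm).neg using 1
          ring)
        continuous_const (fun _ _ => le_rfl) hS0
        (fun u hu => by have := (ih u (hsub hu)).1; simp; linarith)
        (by simpa using h0 i hin) le_rfl (by simpa using hDb i hin t ht)
      rw [hS']
      simp at this
      linarith
    · have := comparison (c := c) (hs i hin) ht.1 hc (fun u hu => hsc i hin u (hsub hu))
        (p := fun u => ∑ j ∈ Finset.range m, u ^ j / (j.factorial : ℝ) * h (i + 1 + j) 0)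
        (D := D) (D' := S) hact hec hdt (by fun_prop) hpos hS0
        (fun u hu => (ih u (hsub hu)).2) le_rfl (h0 i hin) (hDb i hin t ht)
      -- Integrating the transient of `h (i + 1)` raises each `u ^ j / j!` to the next degree, and
      -- `h i 0` supplies the constant term.
      rw [hS']
      have hint := integral_sum_pow_div_factorial (fun j => h (i + j) 0) m t
      simp only [add_zero] at hint
      rw [← hint]
      convert! this using 8
      ring_nf

/-- One term of the exponential series gives `(c t)^j / j! ≤ e^(c t)`. It makes the transient
bounded uniformly in time, as needed when `t_f = ∞`. -/
theorem exp_mul_pow_div_factorial_le {c t : ℝ} (hc : 0 < c) (ht : 0 ≤ t) (j : ℕ) :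
    Real.exp (-c * t) * (t ^ j / (j.factorial : ℝ)) ≤ c⁻¹ ^ j := by
  have h1 := Real.pow_div_factorial_le_exp (c * t) (by positivity) j
  have h2 := mul_le_mul_of_nonneg_left h1 (Real.exp_pos (-c * t)).le
  rw [← Real.exp_add, mul_pow] at h2
  simp only [neg_mul, neg_add_cancel, Real.exp_zero] at h2
  rw [inv_pow, ← one_div, le_div_iff₀ (by positivity)]
  calc _ = Real.exp (-(c * t)) * (c ^ j * t ^ j / (j.factorial : ℝ)) := by rw [neg_mul]; ring
    _ ≤ 1 := h2

theorem geomFactor_eq_sum (n : ℕ) (hn : 1 ≤ n) {c : ℝ} (hc : 0 < c) :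
    geomFactor n c = ∑ k ∈ Finset.range n, c⁻¹ ^ k := by
  unfold geomFactor
  split_ifs with h
  · simp [h]
  · have h1 : c⁻¹ ≠ 1 := by simpa using h
    have h2 : c - 1 ≠ 0 := sub_ne_zero.2 h
    rw [geom_sum_eq h1]
    obtain ⟨m, rfl⟩ : ∃ m, n = m + 1 := ⟨n - 1, by omega⟩
    have h3 : c⁻¹ - 1 ≠ 0 := sub_ne_zero.2 h1
    rw [div_eq_div_iff (by positivity) h3]
    simp only [Nat.add_sub_cancel, inv_pow, pow_succ]
    field_simp
    ring

variable {n p : ℕ}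

/-! ### Smoothness and triangular dependence of the virtual controls, and the chain rule for the
errors. -/

section Calculus

theorem fderiv_pt_apply {a : Pt n p → ℝ} {z : Pt n p} (ha : DifferentiableAt ℝ a z) (v : Pt n p) :
    fderiv ℝ a z v = (∑ k, v.1 k * partialX a k z) + inner ℝ (gradTheta a z) v.2.1 +
      ∑ k, v.2.2 k * partialR a k z := by
  have hv : v = (∑ k, v.1 k • ((EuclideanSpace.single k 1, 0, 0) : Pt n p)) +
      (∑ j, v.2.1 j • ((0, EuclideanSpace.single j 1, 0) : Pt n p)) +
      ∑ k, v.2.2 k • ((0, 0, EuclideanSpace.single k 1) : Pt n p) := by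
    refine Prod.ext ?_ (Prod.ext ?_ ?_)
    all_goals
      ext k
      simp [Prod.fst_sum, Prod.snd_sum, Pi.single_apply]
  conv_lhs => rw [hv]
  simp only [map_add, map_sum, map_smul, smul_eq_mul, partialX, partialR, gradTheta,
    ha.lineDeriv_eq_fderiv, PiLp.inner_apply]
  simp

theorem contDiff_partialX {a : Pt n p → ℝ} (ha : ContDiff ℝ ∞ a) (k : Fin n) :
    ContDiff ℝ ∞ (partialX a k) := by
  have : partialX a k = fun z => fderiv ℝ a z (EuclideanSpace.single k 1, 0, 0) :=
    funext fun z => (ha.differentiable (by simp) z).lineDeriv_eq_fderiv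
  rw [this]
  exact (ha.fderiv_right (by simp)).clm_apply contDiff_const

theorem contDiff_partialR {a : Pt n p → ℝ} (ha : ContDiff ℝ ∞ a) (k : Fin n) :
    ContDiff ℝ ∞ (partialR a k) := by
  have : partialR a k = fun z => fderiv ℝ a z (0, 0, EuclideanSpace.single k 1) :=
    funext fun z => (ha.differentiable (by simp) z).lineDeriv_eq_fderiv
  rw [this]
  exact (ha.fderiv_right (by simp)).clm_apply contDiff_const

theorem contDiff_gradTheta {a : Pt n p → ℝ} (ha : ContDiff ℝ ∞ a) :
    ContDiff ℝ ∞ (gradTheta a) := by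
  refine contDiff_euclidean.2 fun j => ?_
  have : (fun z => gradTheta a z j) =
      fun z => fderiv ℝ a z (0, EuclideanSpace.single j 1, 0) :=
    funext fun z => (ha.differentiable (by simp) z).lineDeriv_eq_fderiv
  rw [this]
  exact (ha.fderiv_right (by simp)).clm_apply contDiff_const

theorem contDiff_state (k : Fin n) : ContDiff ℝ ∞ fun z : Pt n p => z.1 k :=
  contDiff_euclidean.1 contDiff_fst k

theorem contDiff_refValue (k : Fin n) : ContDiff ℝ ∞ fun z : Pt n p => z.2.2 k :=
  contDiff_euclidean.1 (contDiff_snd.comp contDiff_snd) k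

theorem contDiff_errOf {a : Pt n p → ℝ} (ha : ContDiff ℝ ∞ a) (i : Fin n) :
    ContDiff ℝ ∞ (errOf i a) :=
  ((contDiff_state i).sub ha).sub (contDiff_refValue i)

theorem contDiff_driftOf {a : Pt n p → ℝ} (ha : ContDiff ℝ ∞ a) (i : Fin n) :
    ContDiff ℝ ∞ (driftOf i a) :=
  ContDiff.sum fun _ _ => ((contDiff_partialX ha _).mul (contDiff_state _)).add
    ((contDiff_partialR ha _).mul (contDiff_refValue _))

variable {φ : (i : Fin n) → EuclideanSpace ℝ (Fin (i + 1)) → EuclideanSpace ℝ (Fin p)}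
  {c κ g : Fin n → ℝ}

theorem contDiff_regressor (hφ : ∀ i, ContDiff ℝ ∞ (φ i)) (i : Fin n) :
    ContDiff ℝ ∞ fun z : Pt n p => φ i (trunc z.1 i) :=
  (hφ i).comp (contDiff_euclidean.2 fun _ => contDiff_state _)

theorem contDiff_regOf (hφ : ∀ i, ContDiff ℝ ∞ (φ i)) {a : Pt n p → ℝ} (ha : ContDiff ℝ ∞ a)
    (i : Fin n) : ContDiff ℝ ∞ (regOf φ i a) :=
  (contDiff_regressor hφ i).sub <|
    ContDiff.sum fun j _ => (contDiff_partialX ha j).smul (contDiff_regressor hφ j)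

theorem contDiff_dampOf (hφ : ∀ i, ContDiff ℝ ∞ (φ i)) {a : Pt n p → ℝ} (ha : ContDiff ℝ ∞ a)
    (i : Fin n) : ContDiff ℝ ∞ (dampOf φ c κ g i a) :=
  (contDiff_const.add (contDiff_const.mul ((contDiff_regOf hφ ha i).norm_sq ℝ))).add
    (contDiff_const.mul ((contDiff_gradTheta ha).norm_sq ℝ))

theorem virtualControl_zero : virtualControl φ c κ g 0 = fun _ => 0 := rfl

theorem virtualControl_succ (i : Fin n) (z : Pt n p) :
    virtualControl φ c κ g i.succ z =
      -(dampOf φ c κ g i (virtualControl φ c κ g i.castSucc) z *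
          errOf i (virtualControl φ c κ g i.castSucc) z) -
        inner ℝ (regOf φ i (virtualControl φ c κ g i.castSucc) z) z.2.1 +
        driftOf i (virtualControl φ c κ g i.castSucc) z := by
  simp only [virtualControl, Fin.induction_succ]

/-- Every stage differentiates the preceding virtual control; `C^∞` is preserved by this loss of one
derivative. -/
theorem contDiff_virtualControl (hφ : ∀ i, ContDiff ℝ ∞ (φ i)) (i : Fin (n + 1)) :
    ContDiff ℝ ∞ (virtualControl φ c κ g i) := by
  induction i using Fin.induction with
  | zero => exact contDiff_const
  | succ i ih =>
    rw [funext (virtualControl_succ (φ := φ) (c := c) (κ := κ) (g := g) i)]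
    exact (((contDiff_dampOf hφ ih i).mul (contDiff_errOf ih i)).neg.sub
      ((contDiff_regOf hφ ih i).inner ℝ (contDiff_fst.comp contDiff_snd))).add
      (contDiff_driftOf ih i)

/-- Two points with the same parameter estimate and the same state and reference coordinates of
index less than `m`. -/
def AgreeBelow (m : ℕ) (z z' : Pt n p) : Prop :=
  (∀ k : Fin n, (k : ℕ) < m → z.1 k = z'.1 k) ∧ z.2.1 = z'.2.1 ∧
    ∀ k : Fin n, (k : ℕ) < m → z.2.2 k = z'.2.2 k

/-- The function `a` only depends on the state and reference coordinates of index less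
than `m`, and on the parameter estimate. -/
def DependsBelow (m : ℕ) (a : Pt n p → ℝ) : Prop :=
  ∀ z z', AgreeBelow m z z' → a z = a z'

theorem AgreeBelow.add {m : ℕ} {z z' : Pt n p} (h : AgreeBelow m z z') (v : Pt n p) :
    AgreeBelow m (z + v) (z' + v) :=
  ⟨fun k hk => by simp [h.1 k hk], by simp [h.2.1], fun k hk => by simp [h.2.2 k hk]⟩

theorem AgreeBelow.mono {m m' : ℕ} {z z' : Pt n p} (h : AgreeBelow m z z') (hm : m' ≤ m) :
    AgreeBelow m' z z' :=
  ⟨fun k hk => h.1 k (hk.trans_le hm), h.2.1, fun k hk => h.2.2 k (hk.trans_le hm)⟩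

theorem DependsBelow.lineDeriv_eq {m : ℕ} {a : Pt n p → ℝ} (ha : DependsBelow m a) {z z' : Pt n p}
    (h : AgreeBelow m z z') (v : Pt n p) : lineDeriv ℝ a z v = lineDeriv ℝ a z' v := by
  unfold lineDeriv
  congr 1
  exact funext fun t => ha _ _ (h.add _)

theorem DependsBelow.lineDeriv_eq_zero {m : ℕ} {a : Pt n p → ℝ} (ha : DependsBelow m a)
    (z v : Pt n p) (hv : AgreeBelow m v 0) : lineDeriv ℝ a z v = 0 := by
  have : (fun t : ℝ => a (z + t • v)) = fun _ => a z := by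
    refine funext fun t => ha _ _ ⟨fun k hk => ?_, ?_, fun k hk => ?_⟩
    · simpa using Or.inr (hv.1 k hk)
    · simpa using Or.inr hv.2.1
    · simpa using Or.inr (hv.2.2 k hk)
  rw [lineDeriv, this, deriv_const]

theorem DependsBelow.partialX_eq_zero {m : ℕ} {a : Pt n p → ℝ} (ha : DependsBelow m a)
    {k : Fin n} (hk : m ≤ k) (z : Pt n p) : partialX a k z = 0 := by
  refine ha.lineDeriv_eq_zero _ _ ⟨fun l hl => ?_, rfl, fun _ _ => rfl⟩
  have : l ≠ k := fun h => by subst h; omega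
  simp [this]

theorem DependsBelow.partialR_eq_zero {m : ℕ} {a : Pt n p → ℝ} (ha : DependsBelow m a)
    {k : Fin n} (hk : m ≤ k) (z : Pt n p) : partialR a k z = 0 := by
  refine ha.lineDeriv_eq_zero _ _ ⟨fun _ _ => rfl, rfl, fun l hl => ?_⟩
  have : l ≠ k := fun h => by subst h; omega
  simp [this]

theorem DependsBelow.regOf_eq {i : Fin n} {a : Pt n p → ℝ} (ha : DependsBelow i a) {z z' : Pt n p}
    (h : AgreeBelow (i + 1) z z') : regOf φ i a z = regOf φ i a z' := by
  have htr : ∀ j : Fin n, j ≤ i → trunc z.1 j = trunc z'.1 j := by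
    intro j hj
    ext k
    refine h.1 _ ?_
    have h1 : (j : ℕ) ≤ i := hj
    have := k.isLt
    simp
    omega
  unfold regOf
  rw [htr i le_rfl]
  congr 1
  refine Finset.sum_congr rfl fun j hj => ?_
  rw [htr j (Finset.mem_filter.1 hj).2.le]
  congr 1
  exact ha.lineDeriv_eq (h.mono (by omega)) _

theorem DependsBelow.gradTheta_eq {m : ℕ} {a : Pt n p → ℝ} (ha : DependsBelow m a) {z z' : Pt n p}
    (h : AgreeBelow m z z') : gradTheta a z = gradTheta a z' := by
  ext j
  exact ha.lineDeriv_eq h _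

theorem DependsBelow.driftOf_eq {i : Fin n} {a : Pt n p → ℝ} (ha : DependsBelow i a)
    {z z' : Pt n p} (h : AgreeBelow (i + 1) z z') : driftOf i a z = driftOf i a z' := by
  unfold driftOf
  refine Finset.sum_congr rfl fun k _ => ?_
  have h' : AgreeBelow i z z' := h.mono (by omega)
  have hk := k.isLt
  rw [h.1 ⟨k + 1, by omega⟩ (by simp), h.2.2 ⟨k + 1, by omega⟩ (by simp)]
  unfold partialX partialR
  rw [ha.lineDeriv_eq h', ha.lineDeriv_eq h']

/-- Stage `i` reads `x_i`, `r^(i)` and the successors of coordinates below `i`, hence nothing of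
index above `i`. This removes the higher partial derivatives from the chain rule and later drives
the induction bounding the state. -/
theorem dependsBelow_virtualControl (i : Fin (n + 1)) :
    DependsBelow i (virtualControl φ c κ g i) := by
  induction i using Fin.induction with
  | zero => exact fun _ _ _ => rfl
  | succ i ih =>
    intro z z' h
    rw [Fin.val_succ] at h
    rw [Fin.val_castSucc] at ih
    have h' : AgreeBelow i z z' := h.mono (by omega)
    rw [virtualControl_succ, virtualControl_succ, ih.driftOf_eq h, ih.regOf_eq h, h.2.1]
    unfold dampOf errOf
    rw [ih.regOf_eq h, ih.gradTheta_eq h', ih z z' h', h.1 i (by omega), h.2.2 i (by omega)]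

theorem sum_eq_sum_fin_lt (i : Fin n) (F : Fin n → ℝ) (hF : ∀ k, i ≤ k → F k = 0) :
    ∑ k, F k = ∑ k : Fin i, F ⟨k, by omega⟩ := by
  have := Finset.sum_map Finset.univ (Fin.castLEEmb i.isLt.le) F
  refine Eq.trans ?_ this
  symm
  refine Finset.sum_subset (Finset.subset_univ _) fun k _ hk => hF k ?_
  by_contra! hlt
  exact hk (Finset.mem_map.2 ⟨⟨k, hlt⟩, Finset.mem_univ _, rfl⟩)

/-- The error dynamics: the derivative of the error variable along a velocity of the plant. -/
theorem fderiv_errOf_apply {a : Pt n p → ℝ} {z v : Pt n p} {i : Fin n}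
    (hd : DifferentiableAt ℝ a z) (ha : DependsBelow i a) {θ : EuclideanSpace ℝ (Fin p)}
    (hx : ∀ (k : Fin n) (hk : (k : ℕ) + 1 < n), k < i →
      v.1 k = z.1 ⟨k + 1, hk⟩ + inner ℝ (φ k (trunc z.1 k)) θ)
    (hρ : ∀ (k : Fin n) (hk : (k : ℕ) + 1 < n), k < i → v.2.2 k = z.2.2 ⟨k + 1, hk⟩) :
    v.1 i - fderiv ℝ a z v - v.2.2 i =
      v.1 i - inner ℝ (φ i (trunc z.1 i)) θ + inner ℝ (regOf φ i a z) θ - driftOf i a z -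
        inner ℝ (gradTheta a z) v.2.1 - v.2.2 i := by
  -- The vector `w_i` collects every occurrence of `θ`: the one in the equation of `x_i` and those
  -- that the chain rule brings in from `x_j`, `j < i`.
  have hreg : inner ℝ (regOf φ i a z) θ = inner ℝ (φ i (trunc z.1 i)) θ -
      ∑ j : Fin i, partialX a ⟨j, by omega⟩ z *
        inner ℝ (φ ⟨j, by omega⟩ (trunc z.1 ⟨j, by omega⟩)) θ := by
    rw [regOf, inner_sub_left, sum_inner, Finset.sum_filter, sum_eq_sum_fin_lt i]
    · congr 1
      refine Finset.sum_congr rfl fun k _ => ?_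
      rw [if_pos (Fin.lt_def.2 k.isLt), real_inner_smul_left]
    · exact fun k hk => if_neg (not_lt.2 hk)
  rw [fderiv_pt_apply hd, hreg, sum_eq_sum_fin_lt i (fun k => v.1 k * partialX a k z),
    sum_eq_sum_fin_lt i (fun k => v.2.2 k * partialR a k z), driftOf, Finset.sum_add_distrib]
  · have e1 : ∑ k : Fin i, v.1 ⟨k, by omega⟩ * partialX a ⟨k, by omega⟩ z =
        (∑ k : Fin i, partialX a ⟨k, by omega⟩ z * z.1 ⟨k + 1, by omega⟩) +
          ∑ j : Fin i, partialX a ⟨j, by omega⟩ z *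
            inner ℝ (φ ⟨j, by omega⟩ (trunc z.1 ⟨j, by omega⟩)) θ := by
      rw [← Finset.sum_add_distrib]
      refine Finset.sum_congr rfl fun k _ => ?_
      rw [hx ⟨k, by omega⟩ (by simp; omega) (Fin.lt_def.2 k.isLt)]
      ring
    have e2 : ∑ k : Fin i, v.2.2 ⟨k, by omega⟩ * partialR a ⟨k, by omega⟩ z =
        ∑ k : Fin i, partialR a ⟨k, by omega⟩ z * z.2.2 ⟨k + 1, by omega⟩ := by
      refine Finset.sum_congr rfl fun k _ => ?_
      rw [hρ ⟨k, by omega⟩ (by simp; omega) (Fin.lt_def.2 k.isLt)]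
      ring
    rw [e1, e2]
    ring
  · exact fun k hk => by rw [ha.partialR_eq_zero hk, mul_zero]
  · exact fun k hk => by rw [ha.partialX_eq_zero hk, mul_zero]

end Calculus

/-! ### Absolutely continuous curves in metric and Euclidean spaces. -/

section AbsolutelyContinuous

variable {X Y : Type*} [PseudoMetricSpace X] [PseudoMetricSpace Y] {a b : ℝ}

theorem absolutelyContinuous_lipschitz_comp {f : ℝ → X} {F : X → Y} {K : NNReal}
    (hf : AbsolutelyContinuousOnInterval f a b) (hF : LipschitzOnWith K F (f '' uIcc a b)) :
    AbsolutelyContinuousOnInterval (fun t => F (f t)) a b := by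
  have h0 := Filter.Tendsto.const_mul (K : ℝ) hf
  rw [mul_zero] at h0
  refine squeeze_zero' (Eventually.of_forall fun E => Finset.sum_nonneg fun _ _ => dist_nonneg)
    ?_ h0
  filter_upwards [mem_inf_of_right (mem_principal_self _)] with E hE
  rw [Finset.mul_sum]
  exact Finset.sum_le_sum fun i hi => hF.dist_le_mul _ (mem_image_of_mem f (hE.1 i hi).1) _
    (mem_image_of_mem f (hE.1 i hi).2)

theorem absolutelyContinuous_prodMk {f : ℝ → X} {f' : ℝ → Y}
    (hf : AbsolutelyContinuousOnInterval f a b) (hf' : AbsolutelyContinuousOnInterval f' a b) :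
    AbsolutelyContinuousOnInterval (fun t => (f t, f' t)) a b := by
  have h0 := Tendsto.add hf hf'
  rw [add_zero] at h0
  refine squeeze_zero (fun E => Finset.sum_nonneg fun _ _ => dist_nonneg) (fun E => ?_) h0
  rw [← Finset.sum_add_distrib]
  exact Finset.sum_le_sum fun i _ =>
    max_le (le_add_of_nonneg_right dist_nonneg) (le_add_of_nonneg_left dist_nonneg)

/-- A smooth map is only locally Lipschitz, but the curve has compact image, on which it is
Lipschitz. -/
theorem absolutelyContinuous_contDiff_comp {E F : Type*} [NormedAddCommGroup E] [NormedSpace ℝ E]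
    [NormedAddCommGroup F] [NormedSpace ℝ F] {f : ℝ → E} {G : E → F}
    (hf : AbsolutelyContinuousOnInterval f a b) (hG : ContDiff ℝ ∞ G) :
    AbsolutelyContinuousOnInterval (fun t => G (f t)) a b := by
  obtain ⟨K, hK⟩ := LocallyLipschitzOn.exists_lipschitzOnWith_of_compact
    (isCompact_uIcc.image_of_continuousOn hf.continuousOn)
    ((hG.of_le (by simp)).locallyLipschitz.locallyLipschitzOn (s := f '' uIcc a b))
  exact absolutelyContinuous_lipschitz_comp hf hK

theorem hasDerivAt_of_coord {ι : Type*} [Fintype ι] {f : ℝ → EuclideanSpace ℝ ι}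
    {f' : EuclideanSpace ℝ ι} {t : ℝ} (h : ∀ j, HasDerivAt (fun s => f s j) (f' j) t) :
    HasDerivAt f f' t := by
  refine HasFDerivAt.hasDerivAt (hasFDerivWithinAt_univ.1 (hasFDerivWithinAt_euclidean.2
    fun j => ((h j).hasFDerivAt.congr_fderiv ?_).hasFDerivWithinAt)) |>.congr_deriv
      (f := f) (g' := f') (f' := ContinuousLinearMap.toSpanSingleton ℝ f' 1) ?_
  · ext
    simp
  · simp

theorem ae_hasDerivAt_of_absolutelyContinuous {f : ℝ → EuclideanSpace ℝ (Fin p)}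
    (hf : AbsolutelyContinuousOnInterval f a b) :
    ∀ᵐ t, t ∈ uIcc a b → HasDerivAt f (deriv f t) t := by
  have hc : ∀ j, ∀ᵐ t, t ∈ uIcc a b → DifferentiableAt ℝ (fun t => f t j) t := fun j =>
    (absolutelyContinuous_contDiff_comp hf
      (contDiff_euclidean.1 contDiff_id j)).ae_differentiableAt
  filter_upwards [ae_all_iff.2 hc] with t ht hm
  exact (differentiableAt_euclidean.2 fun j => ht j hm).hasDerivAt

end AbsolutelyContinuous

/-! ### Regularity of the reference signal. -/

section Reference

variable {r : ℝ → ℝ}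

/-- The lower derivatives of the reference are continuous, and differentiable off a locally finite
set. -/
theorem IsReference.exists_regular (hr : IsReference n r) : ∃ S : Set ℝ,
    (∀ T : ℝ, (S ∩ Icc 0 T).Finite) ∧ ∀ k < n, ContinuousOn (refDeriv r k) (Ici 0) ∧
      ∀ t ∈ Ici (0 : ℝ) \ S, DifferentiableWithinAt ℝ (refDeriv r k) (Ici 0) t := by
  obtain ⟨S, hS, hd⟩ := hr.piecewise
  refine ⟨S, hS.1, fun k hk => ⟨?_, fun t ht => ?_⟩⟩
  · exact hr.contDiffOn.continuousOn_iteratedDerivWithin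
      (by exact_mod_cast (by omega : k ≤ n - 1)) (uniqueDiffOn_Ici 0)
  · rcases (show k = n - 1 ∨ k < n - 1 by omega) with rfl | h
    · exact hd t ht
    · exact hr.contDiffOn.differentiableOn_iteratedDerivWithin
        (by exact_mod_cast h) (uniqueDiffOn_Ici 0) t ht.1

theorem hasDerivAt_refDeriv {k : ℕ} {t : ℝ} (ht : 0 < t)
    (hd : DifferentiableWithinAt ℝ (refDeriv r k) (Ici 0) t) :
    HasDerivAt (refDeriv r k) (refDeriv r (k + 1) t) t := by
  have h := hd.hasDerivWithinAt.hasDerivAt (Ici_mem_nhds ht)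
  rwa [show derivWithin (refDeriv r k) (Ici 0) t = refDeriv r (k + 1) t by
    rw [refDeriv, iteratedDerivWithin_succ]; rfl] at h

theorem IsReference.ae_hasDerivAt (hr : IsReference n r) (T : ℝ) :
    ∀ᵐ t, t ∈ Icc 0 T → ∀ k < n, HasDerivAt (refDeriv r k) (refDeriv r (k + 1) t) t := by
  obtain ⟨S, hS, hd⟩ := hr.exists_regular
  filter_upwards [((hS T).countable.ae_notMem volume),
    (countable_singleton (0 : ℝ)).ae_notMem volume] with t h1 h2 hm k hk
  exact hasDerivAt_refDeriv (lt_of_le_of_ne hm.1 (Ne.symm h2))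
    ((hd k hk).2 t ⟨hm.1, fun h => h1 ⟨h, hm⟩⟩)

/-- The next derivative is bounded and exists off a locally finite set, while `refDeriv r k` is
continuous; the fundamental theorem with countably many exceptions gives the Lipschitz bound,
including the order `n - 1`, where the derivative may jump. -/
theorem IsReference.exists_lipschitz (hr : IsReference n r) :
    ∃ K : NNReal, ∀ k < n, LipschitzOnWith K (refDeriv r k) (Ici 0) := by
  obtain ⟨S, hS, hd⟩ := hr.exists_regular
  obtain ⟨M, hM⟩ := hr.bounded
  refine ⟨M.toNNReal, fun k hk => LipschitzOnWith.of_dist_le_mul fun s hs t ht => ?_⟩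
  wlog hst : s ≤ t generalizing s t
  · rw [dist_comm, dist_comm s]
    exact this t ht s hs (le_of_not_ge hst)
  have hs0 : 0 ≤ s := hs
  have hder : ∀ u ∈ Ioo s t \ (S ∩ Icc 0 t),
      HasDerivAt (refDeriv r k) (refDeriv r (k + 1) u) u := fun u hu =>
    hasDerivAt_refDeriv (hs0.trans_lt hu.1.1)
      ((hd k hk).2 u ⟨hs0.trans hu.1.1.le, fun h => hu.2 ⟨h, hs0.trans hu.1.1.le, hu.1.2.le⟩⟩)
  have hb : ∀ᵐ u, u ∈ Ioc s t → ‖deriv (refDeriv r k) u‖ ≤ M := by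
    filter_upwards [(hS t).countable.ae_notMem volume,
      (countable_singleton t).ae_notMem volume] with u h1 h2 hu
    rw [(hder u ⟨⟨hu.1, lt_of_le_of_ne hu.2 h2⟩, h1⟩).deriv]
    exact hM (k + 1) hk u (hs0.trans hu.1.le)
  have hint : IntervalIntegrable (deriv (refDeriv r k)) volume s t := by
    rw [intervalIntegrable_iff_integrableOn_Ioc_of_le hst]
    refine Measure.integrableOn_of_bounded (M := M) (by simp)
      (measurable_deriv _).aestronglyMeasurable ?_
    rwa [ae_restrict_iff' measurableSet_Ioc]
  have := integral_eq_of_hasDerivAt_off_countable_of_le (refDeriv r k) (deriv (refDeriv r k)) hst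
    (hS t).countable ((hd k hk).1.mono fun u hu => hs0.trans hu.1)
    (fun u hu => by rw [(hder u hu).deriv]; exact hder u hu) hint
  rw [dist_comm, Real.dist_eq, ← this, dist_comm, Real.dist_eq, ← Real.norm_eq_abs]
  refine (intervalIntegral.norm_integral_le_of_norm_le_const_ae ?_).trans
    (mul_le_mul_of_nonneg_right (Real.le_coe_toNNReal M) (abs_nonneg _))
  rwa [uIoc_of_le hst]

theorem IsReference.absolutelyContinuous (hr : IsReference n r) {T : ℝ} (hT : 0 ≤ T) :
    AbsolutelyContinuousOnInterval
      (fun t => (WithLp.toLp 2 fun k : Fin n => refDeriv r k t : EuclideanSpace ℝ (Fin n))) 0 T := by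
  obtain ⟨K, hK⟩ := hr.exists_lipschitz
  have : LipschitzOnWith K (fun t => fun k : Fin n => refDeriv r k t) (uIcc 0 T) := by
    refine LipschitzOnWith.of_dist_le_mul fun s hs t ht => ?_
    rw [uIcc_of_le hT] at hs ht
    exact (dist_pi_le_iff (by positivity)).2 fun k => (hK k k.isLt).dist_le_mul s hs.1 t ht.1
  exact ((PiLp.lipschitzWith_toLp 2 fun _ : Fin n => ℝ).comp_lipschitzOnWith
    this).absolutelyContinuousOnInterval

end Reference

/-! ### Error dynamics along a closed-loop solution. -/

section Trajectory

variable {φ : (i : Fin n) → EuclideanSpace ℝ (Fin (i + 1)) → EuclideanSpace ℝ (Fin p)}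
  {c κ g : Fin n → ℝ} {r : ℝ → ℝ} {θ : EuclideanSpace ℝ (Fin p)} {tf : EReal}
  {x : ℝ → EuclideanSpace ℝ (Fin n)} {θhat : ℝ → EuclideanSpace ℝ (Fin p)}

theorem Icc_subset_timeInterval {T : ℝ} (hT : T ∈ timeInterval tf) : Icc 0 T ⊆ timeInterval tf :=
  fun _ ht => ⟨ht.1, lt_of_le_of_lt (EReal.coe_le_coe_iff.2 ht.2) hT.2⟩

theorem IsClosedLoop.absolutelyContinuous_ptAt (hr : IsReference n r)
    (hsol : IsClosedLoop φ c κ g r θ tf x θhat) {T : ℝ} (hT : T ∈ timeInterval tf) :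
    AbsolutelyContinuousOnInterval (ptAt r x θhat) 0 T :=
  absolutelyContinuous_prodMk (hsol.x_ac T hT)
    (absolutelyContinuous_prodMk (hsol.θhat_ac T hT) (hr.absolutelyContinuous hT.1))

theorem IsClosedLoop.continuousOn_ptAt (hr : IsReference n r)
    (hsol : IsClosedLoop φ c κ g r θ tf x θhat) {T : ℝ} (hT : T ∈ timeInterval tf) :
    ContinuousOn (ptAt r x θhat) (Icc 0 T) := by
  simpa only [uIcc_of_le hT.1] using (hsol.absolutelyContinuous_ptAt hr hT).continuousOn

/-- The reaction of the `i`-th error variable to the parameter error and to the update law. -/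
def perturbation (φ : (i : Fin n) → EuclideanSpace ℝ (Fin (i + 1)) → EuclideanSpace ℝ (Fin p))
    (c κ g : Fin n → ℝ) (r : ℝ → ℝ) (θ : EuclideanSpace ℝ (Fin p))
    (x : ℝ → EuclideanSpace ℝ (Fin n)) (θhat : ℝ → EuclideanSpace ℝ (Fin p)) (i : Fin n)
    (t : ℝ) : ℝ :=
  inner ℝ (regOf φ i (virtualControl φ c κ g i.castSucc) (ptAt r x θhat t)) (θ - θhat t) -
    inner ℝ (gradTheta (virtualControl φ c κ g i.castSucc) (ptAt r x θhat t)) (deriv θhat t)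

/-- The virtual control of index `i + 1` cancels the drift and replaces `θ` by `θ - θ̂`. What
remains besides `h_{i+1} - s_i h_i` is the estimation error acting through `w_i` and the
uncompensated update law. -/
theorem IsClosedLoop.ae_hasDerivAt_err (hφ : ∀ i, ContDiff ℝ ∞ (φ i)) (hr : IsReference n r)
    (hsol : IsClosedLoop φ c κ g r θ tf x θhat) {T : ℝ} (hT : T ∈ timeInterval tf) :
    ∀ᵐ t, t ∈ Icc 0 T → ∀ i : Fin n,
      HasDerivAt (fun u => err φ c κ g (ptAt r x θhat u) i)
        ((if hi : (i : ℕ) + 1 < n then err φ c κ g (ptAt r x θhat t) ⟨i + 1, hi⟩ else 0) -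
          dampOf φ c κ g i (virtualControl φ c κ g i.castSucc) (ptAt r x θhat t) *
            err φ c κ g (ptAt r x θhat t) i +
          perturbation φ c κ g r θ x θhat i t) t := by
  have hdyn := ae_restrict_of_ae_restrict_of_subset (Icc_subset_timeInterval hT) hsol.dynamics
  rw [ae_restrict_iff' measurableSet_Icc] at hdyn
  have hθ := ae_hasDerivAt_of_absolutelyContinuous (hsol.θhat_ac T hT)
  rw [uIcc_of_le hT.1] at hθ
  filter_upwards [hdyn, hθ, hr.ae_hasDerivAt T] with t h1 h2 h3 ht i
  specialize h1 ht
  specialize h2 ht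
  specialize h3 ht
  set x' : EuclideanSpace ℝ (Fin n) := WithLp.toLp 2 fun i : Fin n =>
    (if hi : (i : ℕ) + 1 < n then x t ⟨i + 1, hi⟩
      else overrideControl φ c κ g (ptAt r x θhat t) (refDeriv r n t)) +
      inner ℝ (φ i (trunc (x t) i)) θ with hx'
  set ρ' : EuclideanSpace ℝ (Fin n) := WithLp.toLp 2 fun k : Fin n => refDeriv r (k + 1) t with hρ'
  have dx : HasDerivAt x x' t := by
    exact hasDerivAt_of_coord h1
  have dρ : HasDerivAt (fun t => (WithLp.toLp 2 fun k : Fin n => refDeriv r k t :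
      EuclideanSpace ℝ (Fin n))) ρ' t := by
    exact hasDerivAt_of_coord fun k => h3 k k.isLt
  have dz : HasDerivAt (ptAt r x θhat) (x', deriv θhat t, ρ') t := dx.prodMk (h2.prodMk dρ)
  set a := virtualControl φ c κ g i.castSucc with ha
  have hda : DifferentiableAt ℝ a (ptAt r x θhat t) :=
    (contDiff_virtualControl hφ i.castSucc).differentiable (by simp) _
  have hdep : DependsBelow i a := by simpa using dependsBelow_virtualControl i.castSucc
  have hmain := ((h1 i).sub (hda.hasFDerivAt.comp_hasDerivAt t dz)).sub (h3 i i.isLt)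
  have hform := fderiv_errOf_apply (φ := φ) (v := (x', deriv θhat t, ρ')) hda hdep (θ := θ)
    (fun k hk _ => by simp [hx', hk, ptAt]) (fun k hk _ => by simp [hρ', ptAt])
  refine HasDerivAt.congr_deriv (f := fun u => err φ c κ g (ptAt r x θhat u) i) hmain ?_
  refine hform.trans ?_
  have hsucc := virtualControl_succ (φ := φ) (c := c) (κ := κ) (g := g) i (ptAt r x θhat t)
  rw [← ha] at hsucc
  have hinner : inner ℝ (regOf φ i a (ptAt r x θhat t)) (θ - θhat t) =
      inner ℝ (regOf φ i a (ptAt r x θhat t)) θ -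
        inner ℝ (regOf φ i a (ptAt r x θhat t)) (θhat t) := inner_sub_right _ _ _
  -- The next state and the override control have the same form, error plus virtual control plus
  -- reference derivative, with error zero in the last equation.
  have hu : (if hi : (i : ℕ) + 1 < n then x t ⟨i + 1, hi⟩
      else overrideControl φ c κ g (ptAt r x θhat t) (refDeriv r n t)) =
      (if hi : (i : ℕ) + 1 < n then err φ c κ g (ptAt r x θhat t) ⟨i + 1, hi⟩ else 0) +
        virtualControl φ c κ g i.succ (ptAt r x θhat t) + refDeriv r (i + 1) t := by
    split_ifs with hi
    · have : (⟨i + 1, hi⟩ : Fin n).castSucc = i.succ := Fin.ext (by simp)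
      simp only [err, errOf, this]
      simp only [ptAt]
      ring
    · have h4 : (i : ℕ) + 1 = n := by omega
      have : Fin.last n = i.succ := Fin.ext (by simp [h4])
      simp only [overrideControl, this, h4, zero_add]
  have hx'i : x' i = _ := congrArg (· + inner ℝ (φ i (trunc (x t) i)) θ) hu
  have herr : err φ c κ g (ptAt r x θhat t) i = errOf i a (ptAt r x θhat t) := rfl
  have hp1 : (ptAt r x θhat t).1 = x t := rfl
  have hp2 : (ptAt r x θhat t).2.1 = θhat t := rfl
  rw [hp2] at hsucc
  have hρi : ρ' i = refDeriv r (i + 1) t := rfl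
  simp only [perturbation, ← ha]
  rw [hinner, hx'i, hsucc, herr, hp1, hρi]
  ring

end Trajectory

/-! ### The damping inequality and the signal norms. -/

section Norms

theorem exists_norm_bound_of_coord {α ι : Type*} [Fintype ι] {I : Set α}
    {v : α → EuclideanSpace ℝ ι} (h : ∀ i, ∃ M : ℝ, ∀ t ∈ I, |v t i| ≤ M) :
    ∃ M : ℝ, ∀ t ∈ I, ‖v t‖ ≤ M := by
  choose M hM using h
  refine ⟨√(∑ i, M i ^ 2), fun t ht => ?_⟩
  rw [EuclideanSpace.norm_eq]
  refine Real.sqrt_le_sqrt (Finset.sum_le_sum fun i _ => ?_)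
  exact pow_le_pow_left₀ (norm_nonneg _) (hM i t ht) 2

/-- AM-GM: `2 √(c κ) y ≤ c + κ y²`. This is the origin of the constants `1 / (2 √(c̲ κ̲))` and `1 /
(2 √(c̲ g̲))`. -/
theorem mul_le_div_sqrt_mul {c κ s y a : ℝ} (hc : 0 < c) (hκ : 0 < κ) (ha : 0 ≤ a)
    (h : c + κ * y ^ 2 ≤ s) : y * a ≤ a / (2 * √(c * κ)) * s := by
  have hq : 0 < √(c * κ) := Real.sqrt_pos.2 (mul_pos hc hκ)
  have h1 : 2 * √(c * κ) * y ≤ s := by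
    rw [Real.sqrt_mul hc.le]
    nlinarith [sq_nonneg (√c - √κ * y), Real.sq_sqrt hc.le, Real.sq_sqrt hκ.le]
  rw [div_mul_eq_mul_div, le_div_iff₀ (by positivity)]
  nlinarith

variable {tf : EReal} {v : ℝ → EuclideanSpace ℝ (Fin p)}

theorem sigNorm_nonneg (q : ℝ≥0∞) : 0 ≤ sigNorm q tf v := ENNReal.toReal_nonneg

theorem ae_norm_le_sigNorm (hv : MemLp v ⊤ (volume.restrict (timeInterval tf))) {T : ℝ}
    (hT : Icc 0 T ⊆ timeInterval tf) : ∀ᵐ t, t ∈ Icc 0 T → ‖v t‖ ≤ sigNorm ⊤ tf v := by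
  rw [← ae_restrict_iff' measurableSet_Icc]
  refine ae_restrict_of_ae_restrict_of_subset hT ?_
  filter_upwards [ae_le_eLpNormEssSup (f := v) (μ := volume.restrict (timeInterval tf))] with t ht
  rw [← eLpNorm_exponent_top] at ht
  have := ENNReal.toReal_mono hv.eLpNorm_ne_top ht
  simpa [sigNorm] using this

theorem integral_norm_sq_le_sigNorm (hv : MemLp v 2 (volume.restrict (timeInterval tf))) {T : ℝ}
    (hT0 : 0 ≤ T) (hT : Icc 0 T ⊆ timeInterval tf) :
    ∫ t in (0 : ℝ)..T, ‖v t‖ ^ 2 ≤ sigNorm 2 tf v ^ 2 := by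
  have h2 : sigNorm 2 tf v ^ 2 = ∫ t in timeInterval tf, ‖v t‖ ^ 2 := by
    rw [sigNorm, hv.eLpNorm_eq_integral_rpow_norm (by simp) (by simp),
      ENNReal.toReal_ofReal (by positivity), ← Real.rpow_natCast, ← Real.rpow_mul (by positivity)]
    simp
  rw [h2, intervalIntegral.integral_of_le hT0]
  exact setIntegral_mono_set hv.norm.integrable_sq
    (Eventually.of_forall fun t => sq_nonneg _) (Ioc_subset_Icc_self.trans hT).eventuallyLE

theorem exists_mem_timeInterval_gt {t : ℝ} (ht : t ∈ timeInterval tf) :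
    ∃ T ∈ timeInterval tf, t < T := by
  obtain ⟨T, h1, h2⟩ := EReal.lt_iff_exists_real_btwn.1 ht.2
  have h1 : t < T := EReal.coe_lt_coe_iff.1 h1
  exact ⟨T, ⟨ht.1.trans h1.le, h2⟩, h1⟩

theorem norm_le_sigNorm (hv : MemLp v ⊤ (volume.restrict (timeInterval tf)))
    (hc : ∀ T ∈ timeInterval tf, ContinuousOn v (Icc 0 T)) {t : ℝ} (ht : t ∈ timeInterval tf) :
    ‖v t‖ ≤ sigNorm ⊤ tf v := by
  obtain ⟨T, hT, htT⟩ := exists_mem_timeInterval_gt ht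
  -- The `max` turns the almost everywhere inequality into an equality of continuous functions,
  -- which extends to every point of the nondegenerate interval `[0, T]`; `T > t` covers `t = 0`.
  have h1 : (fun u => max ‖v u‖ (sigNorm ⊤ tf v)) =ᵐ[volume.restrict (Icc 0 T)]
      fun _ => sigNorm ⊤ tf v := by
    rw [EventuallyEq, ae_restrict_iff' measurableSet_Icc]
    filter_upwards [ae_norm_le_sigNorm hv (Icc_subset_timeInterval hT)] with u hu hm
    exact max_eq_right (hu hm)
  have h2 := Measure.eqOn_Icc_of_ae_eq volume (ht.1.trans_lt htT).ne h1
    ((hc T hT).norm.sup continuousOn_const) continuousOn_const ⟨ht.1, htT.le⟩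
  exact max_eq_right_iff.1 h2

end Norms

/-! ### Initial signs, boundedness of the state, and the safety bound. -/

section Main

variable {φ : (i : Fin n) → EuclideanSpace ℝ (Fin (i + 1)) → EuclideanSpace ℝ (Fin p)}
  {c κ g : Fin n → ℝ} {r : ℝ → ℝ} {θ : EuclideanSpace ℝ (Fin p)} {tf : EReal}
  {x : ℝ → EuclideanSpace ℝ (Fin n)} {θhat : ℝ → EuclideanSpace ℝ (Fin p)}

theorem le_dampOf (hκ : ∀ i, 0 < κ i) (hg : ∀ i, 0 < g i) (i : Fin n) (a : Pt n p → ℝ)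
    (z : Pt n p) : c i ≤ dampOf φ c κ g i a z := by
  have := hκ i
  have := hg i
  have : 0 ≤ κ i * ‖regOf φ i a z‖ ^ 2 + g i * ‖gradTheta a z‖ ^ 2 := by positivity
  unfold dampOf
  linarith

theorem IsClosedLoop.absolutelyContinuous_err (hφ : ∀ i, ContDiff ℝ ∞ (φ i))
    (hr : IsReference n r) (hsol : IsClosedLoop φ c κ g r θ tf x θhat) {T : ℝ}
    (hT : T ∈ timeInterval tf) (i : Fin n) :
    AbsolutelyContinuousOnInterval (fun t => err φ c κ g (ptAt r x θhat t) i) 0 T := by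
  have hF : ContDiff ℝ ∞ (errOf i (virtualControl φ c κ g i.castSucc)) :=
    contDiff_errOf (contDiff_virtualControl hφ _) i
  have h := absolutelyContinuous_contDiff_comp (f := ptAt r x θhat)
    (G := errOf i (virtualControl φ c κ g i.castSucc)) (hsol.absolutelyContinuous_ptAt hr hT) hF
  simpa only [err] using h

/-- Under the gain conditions the initial values of all error variables are nonnegative. -/
theorem err_nonneg (hκ : ∀ i, 0 < κ i) (hg : ∀ i, 0 < g i) {z : Pt n p}
    (hgain : ∀ (i : Fin n) (hi : (i : ℕ) + 1 < n), max (gainLower φ c κ g z i hi) 0 ≤ (c i : EReal))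
    (h0 : ∀ hn : 0 < n, 0 ≤ err φ c κ g z ⟨0, hn⟩) (k : ℕ) (hk : k < n) :
    0 ≤ err φ c κ g z ⟨k, hk⟩ := by
  induction k with
  | zero => exact h0 hk
  | succ k ih =>
    have hkn : k < n := by omega
    specialize ih hkn
    set i : Fin n := ⟨k, hkn⟩ with hi
    -- The next error is the bracket plus the full damping times the current error; as the damping
    -- is at least `c i`, the condition on `c i` alone suffices.
    have hbr : err φ c κ g z ⟨k + 1, hk⟩ = gainBracket φ c κ g z i hk +
        dampOf φ c κ g i (virtualControl φ c κ g i.castSucc) z * err φ c κ g z i := by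
      have h1 : (⟨k + 1, hk⟩ : Fin n).castSucc = i.succ := Fin.ext (by simp [hi])
      simp only [err, errOf, gainBracket, h1, virtualControl_succ]
      simp only [hi]
      ring
    have hle : gainLower φ c κ g z i hk ≤ (c i : EReal) := (le_max_left _ _).trans (hgain i hk)
    unfold gainLower at hle
    rw [hbr]
    split_ifs at hle with h1 h2
    · simp at hle
    -- Zero current error: the value `⊤` has been excluded, so the bracket, which is the next error,
    -- is nonnegative.
    · rw [h1, mul_zero, add_zero]
      exact not_lt.1 h2
    · have hpos : 0 < err φ c κ g z i := lt_of_le_of_ne ih (Ne.symm h1)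
      have h3 := EReal.coe_le_coe_iff.1 hle
      have h4 := mul_le_mul_of_nonneg_right h3 ih
      have h5 : -(err φ c κ g z i)⁻¹ * gainBracket φ c κ g z i hk * err φ c κ g z i =
          -gainBracket φ c κ g z i hk := by field_simp
      have h6 := mul_le_mul_of_nonneg_right
        (le_dampOf (φ := φ) (c := c) hκ hg i (virtualControl φ c κ g i.castSucc) z) ih
      linarith

/-- Replaces the state coordinates of index at least `m` by zero. -/
def cutState (m : ℕ) (z : Pt n p) : Pt n p :=
  (WithLp.toLp 2 fun k : Fin n => if (k : ℕ) < m then z.1 k else 0, z.2.1, z.2.2)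

theorem DependsBelow.cutState {m : ℕ} {a : Pt n p → ℝ} (ha : DependsBelow m a) (z : Pt n p) :
    a (cutState m z) = a z :=
  ha _ _ ⟨fun k hk => by simp [Nonovershooting.cutState, hk], rfl, fun _ _ => rfl⟩

/-- The plant state is bounded if the errors, the estimate and the reference are. -/
theorem bounded_state (hφ : ∀ i, ContDiff ℝ ∞ (φ i)) (hr : IsReference n r)
    (hθ : ∃ M : ℝ, ∀ t ∈ timeInterval tf, ‖θhat t‖ ≤ M)
    (hh : ∀ i, ∃ M : ℝ, ∀ t ∈ timeInterval tf, |err φ c κ g (ptAt r x θhat t) i| ≤ M) :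
    ∃ M : ℝ, ∀ t ∈ timeInterval tf, ‖x t‖ ≤ M := by
  obtain ⟨Mr, hMr⟩ := hr.bounded
  have hρ : ∃ M : ℝ, ∀ t ∈ timeInterval tf, ‖(ptAt r x θhat t).2.2‖ ≤ M :=
    exists_norm_bound_of_coord fun i => ⟨Mr, fun t ht => hMr i i.isLt.le t ht.1⟩
  refine exists_norm_bound_of_coord fun i => ?_
  obtain ⟨k, hk⟩ := i
  induction k using Nat.strong_induction_on with
  | _ k ih =>
    set i : Fin n := ⟨k, hk⟩ with hi
    -- The coordinates from `k` on are not yet known to be bounded. Cutting them off leaves the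
    -- virtual control unchanged and puts its argument in a fixed compact ball.
    have hcut : ∃ M : ℝ, ∀ t ∈ timeInterval tf, ‖(cutState k (ptAt r x θhat t)).1‖ ≤ M := by
      refine exists_norm_bound_of_coord fun j => ?_
      by_cases hj : (j : ℕ) < k
      · obtain ⟨M, hM⟩ := ih j hj j.isLt
        exact ⟨M, fun t ht => by simpa [cutState, hj, ptAt] using hM t ht⟩
      · exact ⟨0, fun t ht => by simp [cutState, hj]⟩
    obtain ⟨M1, h1⟩ := hcut
    obtain ⟨M2, h2⟩ := hθ
    obtain ⟨M3, h3⟩ := hρ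
    obtain ⟨M4, h4⟩ := hh i
    obtain ⟨C, hC⟩ := (isCompact_closedBall (0 : Pt n p)
      (max M1 (max M2 M3))).exists_bound_of_continuousOn
        (contDiff_virtualControl (c := c) (κ := κ) (g := g) hφ i.castSucc).continuous.continuousOn
    have hdep : DependsBelow k (virtualControl φ c κ g i.castSucc) := by
      simpa using dependsBelow_virtualControl i.castSucc
    refine ⟨M4 + C + Mr, fun t ht => ?_⟩
    have ha := hC (cutState k (ptAt r x θhat t)) (by
      rw [mem_closedBall_zero_iff]
      exact max_le_max (h1 t ht) (max_le_max (h2 t ht) (h3 t ht)))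
    rw [hdep.cutState] at ha
    have hx : x t i = err φ c κ g (ptAt r x θhat t) i +
        virtualControl φ c κ g i.castSucc (ptAt r x θhat t) + refDeriv r k t := by
      simp only [err, errOf, ptAt, hi]
      ring
    rw [hx]
    exact (abs_add_le _ _).trans (add_le_add ((abs_add_le _ _).trans
      (add_le_add (h4 t ht) ha)) (hMr k hk.le t ht.1))

/-- The safety bound, given the effect `D` of the perturbations through the variation of constants
formula. -/
theorem safeBound_of_perturbation (hn : 1 ≤ n) (hφ : ∀ i, ContDiff ℝ ∞ (φ i))
    (hr : IsReference n r) (hc : ∀ i, 0 < c i) (hκ : ∀ i, 0 < κ i) (hg : ∀ i, 0 < g i)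
    (hsol : IsClosedLoop φ c κ g r θ tf x θhat)
    (hgain : ∀ (i : Fin n) (hi : (i : ℕ) + 1 < n),
      max (gainLower φ c κ g (ptAt r x θhat 0) i hi) 0 ≤ (c i : EReal))
    (hinit : r 0 ≤ x 0 ⟨0, hn⟩)
    (hθ : ∃ M : ℝ, ∀ t ∈ timeInterval tf, ‖θhat t‖ ≤ M) {D : ℝ} (hD : 0 ≤ D)
    (hP : ∀ T ∈ timeInterval tf, ∀ i, ∀ s : ℝ → ℝ, Continuous s →
      (∀ t ∈ Icc 0 T, s t =
        dampOf φ c κ g i (virtualControl φ c κ g i.castSucc) (ptAt r x θhat t)) →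
      IntervalIntegrable (perturbation φ c κ g r θ x θhat i) volume 0 T →
      ∫ u in (0 : ℝ)..T, Real.exp (∫ τ in (0 : ℝ)..u, s τ) *
          |perturbation φ c κ g r θ x θhat i u| ≤ D * Real.exp (∫ τ in (0 : ℝ)..T, s τ)) :
    SafeBound hn c tf (fun t => err φ c κ g (ptAt r x θhat t)) x
      (geomFactor n (⨅ i, c i) * D) := by
  have : Nonempty (Fin n) := ⟨⟨0, hn⟩⟩
  set c₀ := ⨅ i, c i with hc₀
  have hc0 : 0 < c₀ := by
    obtain ⟨i, hi⟩ := exists_eq_ciInf_of_finite (f := c)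
    rw [hc₀, ← hi]
    exact hc i
  have hc0le : ∀ i, c₀ ≤ c i := fun i => ciInf_le (Set.finite_range c).bddBelow i
  have h0 : ∀ k (hk : k < n), 0 ≤ err φ c κ g (ptAt r x θhat 0) ⟨k, hk⟩ := by
    refine err_nonneg hκ hg hgain fun hn => ?_
    have : (⟨0, hn⟩ : Fin n).castSucc = 0 := rfl
    simp only [err, errOf, this, virtualControl_zero, ptAt, refDeriv, iteratedDerivWithin_zero]
    simpa using hinit
  -- Padding by zero beyond index `n - 1` gives the terminal function of `cascade`.
  set H : ℕ → ℝ → ℝ := fun k t =>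
    if hk : k < n then err φ c κ g (ptAt r x θhat t) ⟨k, hk⟩ else 0 with hH
  have hHfin : ∀ (i : Fin n) t, H i t = err φ c κ g (ptAt r x θhat t) i :=
    fun i t => by simp [hH]
  have hH0 : ∀ k, 0 ≤ H k 0 := by
    intro k
    simp only [hH]
    split_ifs with hk
    · exact h0 k hk
    · exact le_rfl
  have main : ∀ T ∈ timeInterval tf, ∀ m i, i + m = n →
      -(D * ∑ k ∈ Finset.range m, c₀⁻¹ ^ k) ≤ H i T ∧
      H i T ≤ Real.exp (-c₀ * T) *
        (∑ j ∈ Finset.range m, T ^ j / (j.factorial : ℝ) * H (i + j) 0) +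
        D * ∑ k ∈ Finset.range m, c₀⁻¹ ^ k := by
    intro T hT m i him
    set sd : Fin n → ℝ → ℝ := fun i t =>
      dampOf φ c κ g i (virtualControl φ c κ g i.castSucc) (ptAt r x θhat t) with hsd
    have hsdc : ∀ i, ContinuousOn (sd i) (Icc 0 T) := fun i =>
      (contDiff_dampOf hφ (contDiff_virtualControl hφ i.castSucc)
        i).continuous.comp_continuousOn (hsol.continuousOn_ptAt hr hT)
    -- The damping along the solution is continuous only on `[0, T]`; its constant extension past
    -- the endpoints is continuous on `ℝ`, as the integrating factor requires.
    set s : ℕ → ℝ → ℝ := fun k =>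
      if hk : k < n then IccExtend hT.1 ((Icc 0 T).domRestrict (sd ⟨k, hk⟩)) else 0 with hs
    have hseq : ∀ k (hk : k < n), ∀ t ∈ Icc 0 T, s k t = sd ⟨k, hk⟩ t := by
      intro k hk t ht
      simp only [hs, hk, dif_pos]
      rw [IccExtend_of_mem _ _ ht]
      rfl
    have hscont : ∀ k < n, Continuous (s k) := by
      intro k hk
      simp only [hs, hk, dif_pos]
      exact (continuousOn_iff_continuous_domRestrict.1 (hsdc ⟨k, hk⟩)).Icc_extend'
    set d : ℕ → ℝ → ℝ := fun k t =>
      if hk : k < n then perturbation φ c κ g r θ x θhat ⟨k, hk⟩ t else 0 with hd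
    have hder : ∀ k < n, ∀ᵐ t, t ∈ Icc 0 T →
        HasDerivAt (H k) (H (k + 1) t - s k t * H k t + d k t) t := by
      intro k hk
      filter_upwards [hsol.ae_hasDerivAt_err hφ hr hT] with t ht hm
      have := ht hm ⟨k, hk⟩
      rw [hseq k hk t hm]
      simpa only [hH, hd, hk, dif_pos] using this
    have hac : ∀ k < n, AbsolutelyContinuousOnInterval (H k) 0 T := by
      intro k hk
      have : H k = fun t => err φ c κ g (ptAt r x θhat t) ⟨k, hk⟩ := funext (hHfin ⟨k, hk⟩)
      rw [this]
      exact hsol.absolutelyContinuous_err hφ hr hT _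
    have hHc : ∀ k, ContinuousOn (H k) (Icc 0 T) := by
      intro k
      by_cases hk : k < n
      · simpa only [uIcc_of_le hT.1] using (hac k hk).continuousOn
      · simp only [hH, hk, dif_neg, not_false_eq_true]
        exact continuousOn_const
    refine cascade (s := s) (d := d) (T := T) hc0 hD hscont ?_ (fun t => by simp [hH]) hac hder
      (fun k _ => hH0 k) ?_ m i him T ⟨hT.1, le_rfl⟩
    · intro k hk t ht
      rw [hseq k hk t ht]
      exact (hc0le _).trans (le_dampOf hκ hg _ _ _)
    · intro k hk t ht
      have hint := intervalIntegrable_perturbation (hscont k hk) hT.1 (hac k hk) (hHc (k + 1))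
        (hder k hk)
      have hsub : Icc 0 t ⊆ Icc 0 T := Icc_subset_Icc_right ht.2
      have hdk : d k = perturbation φ c κ g r θ x θhat ⟨k, hk⟩ := by simp [hd, hk]
      rw [hdk] at hint ⊢
      refine hP t (Icc_subset_timeInterval hT ht) ⟨k, hk⟩ (s k) (hscont k hk)
        (fun u hu => hseq k hk u (hsub hu)) (hint.mono_set ?_)
      rwa [uIcc_of_le ht.1, uIcc_of_le hT.1]
  have hHb : ∀ i : Fin n, ∃ M : ℝ, ∀ t ∈ timeInterval tf,
      |err φ c κ g (ptAt r x θhat t) i| ≤ M := by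
    intro i
    -- Time-independent bound: each `e^(-c₀ t) t^j / j!` is at most `c₀⁻¹ ^ j`.
    refine ⟨(∑ j ∈ Finset.range (n - i), c₀⁻¹ ^ j * H (i + j) 0) +
      D * ∑ k ∈ Finset.range (n - i), c₀⁻¹ ^ k, fun t ht => ?_⟩
    obtain ⟨hl, hu⟩ := main t ht (n - i) i (by omega)
    have h1 : Real.exp (-c₀ * t) *
        (∑ j ∈ Finset.range (n - i), t ^ j / (j.factorial : ℝ) * H (i + j) 0) ≤
        ∑ j ∈ Finset.range (n - i), c₀⁻¹ ^ j * H (i + j) 0 := by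
      rw [Finset.mul_sum]
      refine Finset.sum_le_sum fun j _ => ?_
      rw [← mul_assoc]
      exact mul_le_mul_of_nonneg_right (exp_mul_pow_div_factorial_le hc0 ht.1 j) (hH0 _)
    have h2 : 0 ≤ ∑ j ∈ Finset.range (n - i), c₀⁻¹ ^ j * H (i + j) 0 :=
      Finset.sum_nonneg fun j _ => mul_nonneg (by positivity) (hH0 _)
    rw [← hHfin]
    exact abs_le.2 ⟨by linarith, by linarith⟩
  refine ⟨exists_norm_bound_of_coord hHb, bounded_state hφ hr hθ hHb, fun t ht => ?_⟩
  obtain ⟨hl, hu⟩ := main t ht n 0 (by omega)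
  rw [geomFactor_eq_sum n hn hc0, mul_comm]
  rw [← Fin.sum_univ_eq_sum_range (fun j => t ^ j / (j.factorial : ℝ) * H (0 + j) 0)] at hu
  simp only [zero_add, hHfin] at hu
  have h0' : H 0 t = err φ c κ g (ptAt r x θhat t) ⟨0, hn⟩ := hHfin ⟨0, hn⟩ t
  rw [h0'] at hl hu
  exact ⟨hl, hu⟩

theorem minTail_le (i : Fin n) (hi : 0 < (i : ℕ)) : minTail g ≤ g i :=
  ciInf_le (f := fun i : {i : Fin n // 0 < (i : ℕ)} => g i) (Set.finite_range _).bddBelow ⟨i, hi⟩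

theorem minTail_pos (hn : 1 < n) (hg : ∀ i, 0 < g i) : 0 < minTail g := by
  have : Nonempty {i : Fin n // 0 < (i : ℕ)} := ⟨⟨⟨1, hn⟩, by simp⟩⟩
  obtain ⟨i, hi⟩ := exists_eq_ciInf_of_finite (f := fun i : {i : Fin n // 0 < (i : ℕ)} => g i)
  rw [minTail, ← hi]
  exact hg i

/-- The update law does not act on the first error variable, which is why the first `g` is left out
of `minTail` and the second term disappears for `n = 1`. -/
theorem gradTheta_virtualControl_zero (i : Fin n) (hi : (i : ℕ) = 0) (z : Pt n p) :
    gradTheta (virtualControl φ c κ g i.castSucc) z = 0 := by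
  have : i.castSucc = 0 := Fin.ext (by simpa using hi)
  rw [this, virtualControl_zero]
  ext j
  simp [gradTheta, lineDeriv]

theorem abs_perturbation_le (i : Fin n) (t : ℝ) :
    |perturbation φ c κ g r θ x θhat i t| ≤
      ‖regOf φ i (virtualControl φ c κ g i.castSucc) (ptAt r x θhat t)‖ * ‖θ - θhat t‖ +
      ‖gradTheta (virtualControl φ c κ g i.castSucc) (ptAt r x θhat t)‖ * ‖deriv θhat t‖ :=
  (abs_sub _ _).trans (add_le_add (abs_real_inner_le_norm _ _) (abs_real_inner_le_norm _ _))

end Main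

end Nonovershooting

end

/-! ### The two cases: bounded and square integrable update law. -/

open Nonovershooting in
theorem lemma1 {n p : ℕ} (hn : 1 ≤ n)
    (φ : (i : Fin n) → EuclideanSpace ℝ (Fin (i + 1)) → EuclideanSpace ℝ (Fin p))
    (hφ : ∀ i, ContDiff ℝ ∞ (φ i))
    (θ : EuclideanSpace ℝ (Fin p))
    (r : ℝ → ℝ) (hr : IsReference n r)
    (c κ g : Fin n → ℝ) (hc : ∀ i, 0 < c i) (hκ : ∀ i, 0 < κ i) (hg : ∀ i, 0 < g i)
    (tf : EReal) (htf : 0 < tf)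
    (x : ℝ → EuclideanSpace ℝ (Fin n)) (θhat : ℝ → EuclideanSpace ℝ (Fin p))
    (hsol : IsClosedLoop φ c κ g r θ tf x θhat)
    (hgain : ∀ (i : Fin n) (hi : (i : ℕ) + 1 < n),
      max (gainLower φ c κ g (ptAt r x θhat 0) i hi) 0 ≤ (c i : EReal))
    (hinit : r 0 ≤ x 0 ⟨0, hn⟩) :
    (MemLp (fun t => θ - θhat t) ⊤ (volume.restrict (timeInterval tf)) →
      MemLp (deriv θhat) ⊤ (volume.restrict (timeInterval tf)) →
      SafeBound hn c tf (fun t => err φ c κ g (ptAt r x θhat t)) x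
        (violationInf c κ g (sigNorm ⊤ tf fun t => θ - θhat t) (sigNorm ⊤ tf (deriv θhat)))) ∧
    (MemLp (fun t => θ - θhat t) ⊤ (volume.restrict (timeInterval tf)) →
      MemLp (deriv θhat) 2 (volume.restrict (timeInterval tf)) →
      SafeBound hn c tf (fun t => err φ c κ g (ptAt r x θhat t)) x
        (violationTwo c κ g (sigNorm ⊤ tf fun t => θ - θhat t) (sigNorm 2 tf (deriv θhat)))) := by
  have : Nonempty (Fin n) := ⟨⟨0, hn⟩⟩
  have hpos : ∀ f : Fin n → ℝ, (∀ i, 0 < f i) → 0 < ⨅ i, f i := by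
    intro f hf
    obtain ⟨i, hi⟩ := exists_eq_ciInf_of_finite (f := f)
    exact hi ▸ hf i
  have hle : ∀ (f : Fin n → ℝ) i, ⨅ i, f i ≤ f i :=
    fun f i => ciInf_le (Set.finite_range f).bddBelow i
  have hc0 := hpos c hc
  have hκ0 := hpos κ hκ
  set w : Fin n → ℝ → ℝ := fun i t =>
    ‖regOf φ i (virtualControl φ c κ g i.castSucc) (ptAt r x θhat t)‖ with hw
  set q : Fin n → ℝ → ℝ := fun i t =>
    ‖gradTheta (virtualControl φ c κ g i.castSucc) (ptAt r x θhat t)‖ with hq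
  have hdamp : ∀ i t, dampOf φ c κ g i (virtualControl φ c κ g i.castSucc) (ptAt r x θhat t) =
      c i + κ i * w i t ^ 2 + g i * q i t ^ 2 := fun i t => rfl
  have hwle : ∀ i t (a : ℝ), 0 ≤ a → w i t * a ≤ a / (2 * √((⨅ i, c i) * ⨅ i, κ i)) *
      dampOf φ c κ g i (virtualControl φ c κ g i.castSucc) (ptAt r x θhat t) := by
    intro i t a ha
    refine mul_le_div_sqrt_mul hc0 hκ0 ha ?_
    rw [hdamp]
    have h1 := mul_le_mul_of_nonneg_right (hle κ i) (sq_nonneg (w i t))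
    have h2 := mul_nonneg (hg i).le (sq_nonneg (q i t))
    linarith [hle c i]
  have hq0 : ∀ i : Fin n, (i : ℕ) = 0 → ∀ t, q i t = 0 := fun i hi t => by
    simp only [hq, gradTheta_virtualControl_zero i hi, norm_zero]
  set a := sigNorm ⊤ tf fun t => θ - θhat t with ha
  have ha0 : 0 ≤ a := sigNorm_nonneg _
  have hθcont : ∀ T ∈ timeInterval tf, ContinuousOn (fun t => θ - θhat t) (Icc 0 T) := by
    intro T hT
    have := (hsol.θhat_ac T hT).continuousOn
    rw [uIcc_of_le hT.1] at this
    exact continuousOn_const.sub this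
  -- The estimate is bounded because `θ` is constant and `θ̃` is bounded at every time by
  -- continuity; nothing about `θ̂'` is needed.
  have hθb : MemLp (fun t => θ - θhat t) ⊤ (volume.restrict (timeInterval tf)) →
      ∃ M : ℝ, ∀ t ∈ timeInterval tf, ‖θhat t‖ ≤ M := fun hm => ⟨‖θ‖ + a, fun t ht => by
    have h1 := norm_le_sigNorm hm hθcont ht
    have h2 := norm_sub_le θ (θ - θhat t)
    rw [sub_sub_cancel] at h2
    linarith⟩
  have hA0 : 0 ≤ a / (2 * √((⨅ i, c i) * ⨅ i, κ i)) := by positivity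
  have hqc : ∀ i, ∀ T ∈ timeInterval tf, ContinuousOn (q i) (Icc 0 T) := fun i T hT =>
    ((contDiff_gradTheta (contDiff_virtualControl hφ i.castSucc)).continuous.comp_continuousOn
      (hsol.continuousOn_ptAt hr hT)).norm
  refine ⟨fun hm hm' => ?_, fun hm hm' => ?_⟩
  · set b := sigNorm ⊤ tf (deriv θhat) with hb
    have hb0 : 0 ≤ b := sigNorm_nonneg _
    have hB0 : 0 ≤ if n = 1 then 0 else b / (2 * √((⨅ i, c i) * minTail g)) := by
      split_ifs <;> positivity
    refine safeBound_of_perturbation hn hφ hr hc hκ hg hsol hgain hinit (hθb hm)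
      (add_nonneg hA0 hB0) fun T hT i s hs hseq hint =>
        integral_exp_mul_abs_le hs hT.1 (add_nonneg hA0 hB0) hint ?_
    filter_upwards [ae_norm_le_sigNorm hm' (Icc_subset_timeInterval hT)] with t ht hmt
    refine (abs_perturbation_le i t).trans ?_
    rw [add_mul, hseq t hmt]
    refine add_le_add ((mul_le_mul_of_nonneg_left
      (norm_le_sigNorm hm hθcont (Icc_subset_timeInterval hT hmt)) (norm_nonneg _)).trans
      (hwle i t a ha0)) ?_
    -- In the first equation the update term vanishes; in the others `n ≥ 2`, so `minTail g` is a
    -- genuine minimum.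
    by_cases hi : (i : ℕ) = 0
    · have hd0 := (hc i).le.trans (le_dampOf (φ := φ) (c := c) hκ hg i
        (virtualControl φ c κ g i.castSucc) (ptAt r x θhat t))
      have := hq0 i hi t
      simp only [hq] at this
      rw [this, zero_mul]
      exact mul_nonneg hB0 hd0
    · have hn1 : n ≠ 1 := by have := i.isLt; omega
      rw [if_neg hn1]
      refine (mul_le_mul_of_nonneg_left (ht hmt) (norm_nonneg _)).trans ?_
      refine mul_le_div_sqrt_mul hc0 (minTail_pos (by omega) hg) hb0 ?_
      rw [hdamp]
      have h1 := mul_le_mul_of_nonneg_right (minTail_le (g := g) i (by omega)) (sq_nonneg (q i t))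
      have h2 := mul_nonneg (hκ i).le (sq_nonneg (w i t))
      simp only [hq, hw] at h1 h2 ⊢
      linarith [hle c i]
  · set b := sigNorm 2 tf (deriv θhat) with hb
    have hb0 : 0 ≤ b := sigNorm_nonneg _
    have hB0 : 0 ≤ if n = 1 then 0 else b / √(2 * minTail g) := by
      split_ifs <;> positivity
    refine safeBound_of_perturbation hn hφ hr hc hκ hg hsol hgain hinit (hθb hm)
      (add_nonneg hA0 hB0) fun T hT i s hs hseq hint => ?_
    have hpert : ∀ t ∈ Icc 0 T, |perturbation φ c κ g r θ x θhat i t| ≤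
        a / (2 * √((⨅ i, c i) * ⨅ i, κ i)) * s t + q i t * ‖deriv θhat t‖ := by
      intro t ht
      refine (abs_perturbation_le i t).trans (add_le_add_left ?_ _)
      rw [hseq t ht]
      exact (mul_le_mul_of_nonneg_left
        (norm_le_sigNorm hm hθcont (Icc_subset_timeInterval hT ht)) (norm_nonneg _)).trans
        (hwle i t a ha0)
    -- The first equation contains only the part dominated by the damping; the later ones also have
    -- the square integrable factor, controlled by `minTail g * q i t ^ 2 ≤ s t`.
    by_cases hi : (i : ℕ) = 0
    · refine (integral_exp_mul_abs_le hs hT.1 hA0 hint (Eventually.of_forall fun t ht => ?_)).trans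
        (mul_le_mul_of_nonneg_right (le_add_of_nonneg_right hB0) (Real.exp_pos _).le)
      simpa [hq0 i hi] using hpert t ht
    · have hn1 : n ≠ 1 := by have := i.isLt; omega
      rw [if_neg hn1]
      refine integral_exp_mul_abs_le_of_sq hs hT.1 hA0 (minTail_pos (by omega) hg) hb0 hint
        (hqc i T hT) (fun t => norm_nonneg _) (fun t => norm_nonneg _) (fun t ht => ?_)
        (hm'.mono_measure (Measure.restrict_mono
          (Ioc_subset_Icc_self.trans (Icc_subset_timeInterval hT)) le_rfl)).norm
        (integral_norm_sq_le_sigNorm hm' hT.1 (Icc_subset_timeInterval hT))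
        (Eventually.of_forall hpert)
      rw [hseq t ht, hdamp]
      have h1 := mul_le_mul_of_nonneg_right (minTail_le (g := g) i (by omega)) (sq_nonneg (q i t))
      have h2 := mul_nonneg (hκ i).le (sq_nonneg (w i t))
      linarith [(hc i).le]
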